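/- Consider the lattice TASEP on $\mathbb{Z}$ with $v=1$, $r=1/2$ and $0<p<1$: configurations are sequences $x=(x_i)_{i\in\mathbb{Z}}$ of integers with $x_i+1\le x_{i+1}$, and at each time step, simultaneously and independently for all $i$, the particle $i$ moves from $x_i^t$ to $x_i^{t+1}=\min\{x_i^t+1,\,x_{i+1}^t-1\}$ with probability $p$ and stays, $x_i^{t+1}=x_i^t$, with probability $1-p$. Let $0<\rho\le 1$. Then for every initial configuration $x^0=x$ of density $\rho$, i.e. with $\lim_{n\to\infty} n/(x_{n-1}-x_0)=\rho$, almost surely, for every $i\in\mathbb{Z}$, $$\lim_{t\to\infty}\frac{x_i^t-x_i^0}{t}=V(\rho):=\frac{1-\sqrt{1-4p\rho(1-\rho)}}{2\rho}.$$ Moreover, for $0<\rho<1$, consider the induced process of occupied sites on $\{0,1\}^{\mathbb{Z}}$ (where $1$ means an occupied site) and the Markov measures $\mu$ on $\{0,1\}^{\mathbb{Z}}$, given by a $2\times2$ stochastic matrix $(p_{ij})_{i,j\in\{0,1\}}$ with positive entries and its normalized left eigenvector $(p_0,p_1)$ through $\mu([a_1\dots a_n])=p_{a_1}\prod_{i=1}^{n-1}p_{a_i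 a_{i+1}}$ on each cylinder of configurations reading $a_1\dots a_n$ at $n$ given consecutive sites. There is such a Markov measure which is invariant under the process and has particle density $\mu([1])=\rho$, and for each such measure $V(\rho)=p\,p_{10}$. -/

import Mathlib

open MeasureTheory ProbabilityTheory Filter Topology

namespace LatticeTASEP

/-- An admissible configuration of labelled balls of radius `1/2` centred at lattice sites:
the centres satisfy `x i + 1/2 ≤ x (i+1) - 1/2`. -/
def Admissible (x : ℤ → ℤ) : Prop :=
  ∀ i : ℤ, x i + 1 ≤ x (i + 1)

/-- The configuration `x` has density `ρ`: the number of particles `n` among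
`x 0, …, x (n-1)` divided by the length `x (n-1) - x 0` tends to `ρ`. -/
def HasDensity (x : ℤ → ℤ) (ρ : ℝ) : Prop :=
  Tendsto (fun n : ℕ => (n : ℝ) / ((x ((n : ℤ) - 1) : ℝ) - (x 0 : ℝ))) atTop (𝓝 ρ)

/-- The law of a family of independent coins indexed by `ι`, each of them showing `true` with
probability `p` and `false` with probability `1 - p`. -/
noncomputable def coins (ι : Type) (p : unitInterval) : Measure (ι → Bool) :=
  Measure.infinitePi fun _ : ι => bernoulliMeasure true false p

/-- One time step of the dynamics of labelled particles (maximal jump `1`, radius `1/2`), all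
particles being updated simultaneously: the particle `i` moves to
`min (x i + 1) (x (i+1) - 1)` if its coin shows `true` and stays otherwise. -/
def step (c : ℤ → Bool) (x : ℤ → ℤ) : ℤ → ℤ :=
  fun i => if c i = true then min (x i + 1) (x (i + 1) - 1) else x i

/-- The configuration at time `t` started from `x`; `ω (t, i)` is the coin used by the
particle `i` in the step from time `t` to time `t + 1`. -/
def trajectory (x : ℤ → ℤ) (ω : ℕ × ℤ → Bool) : ℕ → ℤ → ℤ
  | 0 => x
  | t + 1 => step (fun i => ω (t, i)) (trajectory x ω t)

/-- The average velocity of the particle `i` during the time `t`. -/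
noncomputable def averageVelocity (x : ℤ → ℤ) (ω : ℕ × ℤ → Bool) (i : ℤ) (t : ℕ) : ℝ :=
  ((trajectory x ω t i : ℝ) - (x i : ℝ)) / (t : ℝ)

/-- `V` is the average velocity for the initial configuration `x`: almost surely, the average
velocity of each particle during the time `t` tends to `V` as `t → ∞`. -/
def HasVelocity (p : unitInterval) (x : ℤ → ℤ) (V : ℝ) : Prop :=
  ∀ᵐ ω ∂(coins (ℕ × ℤ) p), ∀ i : ℤ, Tendsto (averageVelocity x ω i) atTop (𝓝 V)

/-- In the occupation configuration `η` (`1` is a particle, `0` is an empty site) with coins `c`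
a particle jumps from the site `k` to the site `k + 1`. -/
def Jumps (c : ℤ → Bool) (η : ℤ → Fin 2) (k : ℤ) : Prop :=
  η k = 1 ∧ η (k + 1) = 0 ∧ c k = true

open Classical in
/-- One time step of the same dynamics with indistinguishable particles: a site is occupied after
the step iff its particle has not left or a particle has arrived from the left. -/
noncomputable def siteStep (c : ℤ → Bool) (η : ℤ → Fin 2) : ℤ → Fin 2 :=
  fun k => if (η k = 1 ∧ ¬ Jumps c η k) ∨ Jumps c η (k - 1) then 1 else 0

/-- The measure `μ` on occupation configurations is invariant for the process: if `η` has law `μ`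
and the coins are independent of `η`, then the configuration after one step has law `μ`. -/
def Invariant (p : unitInterval) (μ : Measure (ℤ → Fin 2)) : Prop :=
  Measure.map (fun q : (ℤ → Fin 2) × (ℤ → Bool) => siteStep q.2 q.1) (μ.prod (coins ℤ p)) = μ

/-- `P` is a probability (row-stochastic) matrix with positive entries. -/
def IsPositiveStochastic (P : Matrix (Fin 2) (Fin 2) ℝ) : Prop :=
  (∀ i j, 0 < P i j) ∧ ∀ i, ∑ j, P i j = 1

/-- `μ` is the (spatially) Markov measure with transition matrix `P`: for the normalized left
eigenvector `π` of `P`, the cylinder of configurations that read `a 0, …, a n` at the consecutive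
sites `k, …, k + n` has measure `π (a 0) * P (a 0) (a 1) * ⋯ * P (a (n-1)) (a n)`. -/
def IsMarkovMeasure (P : Matrix (Fin 2) (Fin 2) ℝ) (μ : Measure (ℤ → Fin 2)) : Prop :=
  ∃ π : Fin 2 → ℝ, (∀ i, 0 ≤ π i) ∧ ∑ i, π i = 1 ∧ Matrix.vecMul π P = π ∧
    ∀ (k : ℤ) (n : ℕ) (a : ℕ → Fin 2),
      μ {η | ∀ j : ℕ, j ≤ n → η (k + (j : ℤ)) = a j} =
        ENNReal.ofReal (π (a 0) * ∏ j ∈ Finset.range n, P (a j) (a (j + 1)))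

/-- `μ` is a Markov measure with positive transition matrix `P` which is invariant for the process
and whose particle density (the probability that a site is occupied) is `ρ`. -/
structure IsMarkovInvariant (p : unitInterval) (ρ : ℝ) (P : Matrix (Fin 2) (Fin 2) ℝ)
    (μ : Measure (ℤ → Fin 2)) : Prop where
  isProbabilityMeasure : IsProbabilityMeasure μ
  positiveStochastic : IsPositiveStochastic P
  markov : IsMarkovMeasure P μ
  invariant : Invariant p μ
  density : ∀ k : ℤ, μ {η | η k = 1} = ENNReal.ofReal ρ

end LatticeTASEP

/-! The law of large numbers follows from Burke's theorem and a coupling.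

Call the empty sites in front of a particle its queue, the jumps of the next particle arrivals, and
its own jumps departures. For `0 < α < p` let `gapLaw p α` be the law on `ℕ` that is stationary for
a queue with service probability `p` and with independent arrivals of probability `α`. In one step
of such a queue, the departure is again a coin of probability `α` and is independent of the queue
left behind (`map_queueStep`). Iterated in time, this shows that the departures of a stationary
queue are again independent coins (`map_departures`). In the infinite tandem of queues with
independent gaps of law `gapLaw p α`, the law `ν` of the jumps of one particle solves `ν = Γ (ε ⊗
ν)`, because the arrivals are the jumps of the next particle, which have the same law. Since a jump
takes a unit of time to influence the particle behind, this recursion has a unique solution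
(`eq_of_causal_recursion`), and Burke's theorem identifies it with independent coins of probability
`α` (`map_firstJumps`). The strong law of large numbers and Fubini's theorem then yield a
deterministic configuration with mean spacing `1 + α (1 - α) / (p - α)` and velocity `α`
(`exists_spaced_velocity`). The dynamics preserves the order of labelled configurations, and a
particle is influenced only by those in front of it. So a configuration of density `ρ` is slower
than the ones with `α > V(ρ)`, whose spacing exceeds `1 / ρ`, and faster than the ones with `α <
V(ρ)` (`hasVelocity`).

For the second part, the configuration `η'` after one step from a Markov measure is read from left
to right together with the state of the bond after the last site: whether a particle jumps across
it, and the occupation of its right end. The weights of these states obey a linear recursion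
(`measureReal_forward`). With `a = P 1 0` and `b = P 0 1`, if `a + b = 1 + p a b` then the state,
given what has been read, depends only on the last site (`readWeight_bondLaw`), so `η'` has the law
of the original chain. Conversely, invariance of the probability of the word `10` forces that
equation (`transition_of_invariant`). It turns into the quadratic equation of `V(ρ)` for `p a`, and
`a, b < 1` selects the root (`mul_eq_velocity`). The stationary chain itself is obtained by gluing
two one-sided chains at the origin, which is possible because a two-state chain is reversible. -/

namespace LatticeTASEP

/-! ### Sequences, their truncations, and measures that solve a causal recursion -/

/-- The sequence `b, s 0, s 1, …`. -/
def cons {B : Type*} (b : B) (s : ℕ → B) : ℕ → B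
  | 0 => b
  | n + 1 => s n

/-- The sequence that agrees with `s` before `n` and has the default value from `n` on. -/
def trunc {B : Type*} [Inhabited B] (n : ℕ) (s : ℕ → B) : ℕ → B :=
  fun k => if k < n then s k else default

@[simp] lemma cons_zero {B : Type*} (b : B) (s : ℕ → B) : cons b s 0 = b := rfl

@[simp] lemma cons_succ {B : Type*} (b : B) (s : ℕ → B) (n : ℕ) : cons b s (n + 1) = s n := rfl

@[fun_prop]
lemma measurable_cons {B Ω : Type*} [MeasurableSpace B] [MeasurableSpace Ω] {f : Ω → B}
    {g : Ω → ℕ → B} (hf : Measurable f) (hg : Measurable g) :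
    Measurable fun q => cons (f q) (g q) := by
  refine measurable_pi_lambda _ fun n => ?_
  cases n with
  | zero => exact hf
  | succ n => exact (measurable_pi_apply n).comp hg

@[fun_prop]
lemma measurable_trunc {B : Type*} [MeasurableSpace B] [Inhabited B] (n : ℕ) :
    Measurable (trunc n : (ℕ → B) → ℕ → B) := by
  refine measurable_pi_lambda _ fun k => ?_
  unfold trunc
  split_ifs
  · exact measurable_pi_apply k
  · exact measurable_const

lemma eq_infinitePi_of_range {B : Type*} [MeasurableSpace B] (β : Measure B)
    [IsProbabilityMeasure β] {ν : Measure (ℕ → B)}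
    (h : ∀ (n : ℕ) (t : ℕ → Set B), (∀ i, MeasurableSet (t i)) →
      ν {s | ∀ i < n, s i ∈ t i} = ∏ i ∈ Finset.range n, β (t i)) :
    ν = Measure.infinitePi fun _ => β := by
  classical
  refine Measure.eq_infinitePi _ fun s t ht => ?_
  obtain ⟨n, hn⟩ := s.exists_nat_subset_range
  have := h n (fun i => if i ∈ s then t i else Set.univ) (fun i => by
    split_ifs
    exacts [ht i, MeasurableSet.univ])
  have hset : (Set.pi (s : Set ℕ) t) =
      {x | ∀ i < n, x i ∈ (if i ∈ s then t i else Set.univ)} := by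
    ext x
    simp only [Set.mem_pi, Finset.mem_coe, Set.mem_ofPred_eq]
    constructor
    · intro hx i _
      split_ifs with hi
      exacts [hx i hi, trivial]
    · intro hx i hi
      have := hx i (Finset.mem_range.1 (hn hi))
      rwa [if_pos hi] at this
  rw [hset, this]
  rw [← Finset.prod_subset hn]
  · exact Finset.prod_congr rfl fun i hi => by rw [if_pos hi]
  · intro i _ hi
    rw [if_neg hi, measure_univ]

lemma map_cons_infinitePi {B : Type*} [MeasurableSpace B] (β : Measure B)
    [IsProbabilityMeasure β] :
    (β.prod (Measure.infinitePi fun _ : ℕ => β)).map (fun q => cons q.1 q.2) =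
      Measure.infinitePi fun _ => β := by
  refine eq_infinitePi_of_range β fun n t ht => ?_
  have hm : MeasurableSet {s : ℕ → B | ∀ i < n, s i ∈ t i} := by
    have : {s : ℕ → B | ∀ i < n, s i ∈ t i} = Set.pi (Finset.range n : Set ℕ) t := by
      ext; simp
    rw [this]
    exact MeasurableSet.pi (Finset.countable_toSet _) fun i _ => ht i
  rw [Measure.map_apply (by fun_prop) hm]
  cases n with
  | zero => simp
  | succ n =>
    have hset : (fun q : B × (ℕ → B) => cons q.1 q.2) ⁻¹' {s | ∀ i < n + 1, s i ∈ t i} =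
        t 0 ×ˢ Set.pi (Finset.range n : Set ℕ) (fun i => t (i + 1)) := by
      ext q
      simp only [Set.mem_preimage, Set.mem_ofPred_eq, Set.mem_prod, Set.mem_pi, Finset.coe_range,
        Set.mem_Iio]
      constructor
      · exact fun h => ⟨h 0 (Nat.succ_pos n), fun i hi => h (i + 1) (by omega)⟩
      · rintro ⟨h0, h1⟩ (_ | i) hi
        exacts [h0, h1 i (by omega)]
    rw [hset, Measure.prod_prod, Measure.infinitePi_pi _ fun i _ => ht (i + 1),
      Finset.prod_range_succ', mul_comm]

lemma ext_of_map_trunc {B : Type*} [MeasurableSpace B] [Inhabited B] {ν₁ ν₂ : Measure (ℕ → B)}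
    [IsProbabilityMeasure ν₁] [IsProbabilityMeasure ν₂]
    (h : ∀ n, ν₁.map (trunc n) = ν₂.map (trunc n)) : ν₁ = ν₂ := by
  refine IsProjectiveLimit.unique (P := fun I : Finset ℕ => ν₂.map I.restrict) (fun I => ?_)
    fun I => rfl
  obtain ⟨n, hn⟩ := I.exists_nat_subset_range
  have hr : (I.restrict : (ℕ → B) → _) = I.restrict ∘ trunc n := by
    ext s i
    simp [trunc, Finset.mem_range.1 (hn i.2)]
  rw [hr, ← Measure.map_map (by fun_prop) (by fun_prop), h n,
    Measure.map_map (by fun_prop) (by fun_prop), ← hr]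

/-- A recursion `ν = Γ (ε ⊗ ν)` for the law of a random sequence has at most one solution if `Γ` is
causal with delay: the first `n + 1` terms of the output depend on the first `n` terms of the input
only. -/
theorem eq_of_causal_recursion {B E : Type*} [MeasurableSpace B] [Inhabited B] [MeasurableSpace E]
    {ν₁ ν₂ : Measure (ℕ → B)} [IsProbabilityMeasure ν₁] [IsProbabilityMeasure ν₂]
    (ε : Measure E) [IsProbabilityMeasure ε] (Γ : E × (ℕ → B) → ℕ → B) (hΓ : Measurable Γ)
    (causal : ∀ n e s, trunc (n + 1) (Γ (e, s)) = trunc (n + 1) (Γ (e, trunc n s)))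
    (h₁ : (ε.prod ν₁).map Γ = ν₁) (h₂ : (ε.prod ν₂).map Γ = ν₂) : ν₁ = ν₂ := by
  refine ext_of_map_trunc fun n => ?_
  induction n with
  | zero =>
    have : (trunc 0 : (ℕ → B) → ℕ → B) = fun _ _ => default := by
      ext s k
      simp [trunc]
    simp [this]
  | succ n ih =>
    have key : ∀ ν : Measure (ℕ → B), IsProbabilityMeasure ν → (ε.prod ν).map Γ = ν →
        ν.map (trunc (n + 1)) = (ε.prod (ν.map (trunc n))).map (trunc (n + 1) ∘ Γ) := by
      intro ν _ h
      have hid : ε.prod (ν.map (trunc n)) = (ε.prod ν).map (Prod.map id (trunc n)) := by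
        rw [← Measure.map_prod_map _ _ measurable_id (measurable_trunc n), Measure.map_id]
      rw [hid, Measure.map_map (by fun_prop) (by fun_prop)]
      conv_lhs => rw [← h, Measure.map_map (by fun_prop) hΓ]
      congr 1
      ext1 q
      exact causal n q.1 q.2
    rw [key ν₁ inferInstance h₁, key ν₂ inferInstance h₂, ih]

/-! ### The stationary gap law and the output of a single queue -/

/-- The law of one coin that shows `true` with probability `p`. -/
noncomputable abbrev coin (p : unitInterval) : Measure Bool := bernoulliMeasure true false p

/-- The stationary probability that there are `k` empty sites between two consecutive particles
which move with velocity `α`. -/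
noncomputable def gapWeight (p α : ℝ) : ℕ → ℝ
  | 0 => 1 - α / p
  | k + 1 => (1 - α / p) * (α / (p * (1 - α))) * (α * (1 - p) / (p * (1 - α))) ^ k

/-- The measure on `ℕ` with the weights `gapWeight p α`. -/
noncomputable def gapLaw (p α : ℝ) : Measure ℕ :=
  Measure.sum fun k => ENNReal.ofReal (gapWeight p α k) • Measure.dirac k

lemma gapLaw_singleton (p α : ℝ) (k : ℕ) :
    gapLaw p α {k} = ENNReal.ofReal (gapWeight p α k) := by
  rw [gapLaw, Measure.sum_apply _ (measurableSet_singleton k), tsum_eq_single k]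
  · simp
  · intro j hj
    simp [hj]

section

variable {p α : ℝ} (hα0 : 0 < α) (hαp : α < p) (hp1 : p < 1)

include hα0 hαp hp1

lemma gapWeight_nonneg (k : ℕ) : 0 ≤ gapWeight p α k := by
  have h1 : 0 < p := hα0.trans hαp
  have h2 : 0 < 1 - α := by linarith
  have h3 : 0 < 1 - p := by linarith
  have h4 : 0 ≤ 1 - α / p := by rw [sub_nonneg, div_le_one h1]; exact hαp.le
  cases k with
  | zero => exact h4
  | succ k => unfold gapWeight; positivity

lemma gapRatio_lt_one : ‖α * (1 - p) / (p * (1 - α))‖ < 1 := by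
  have h1 : 0 < p := hα0.trans hαp
  have h2 : 0 < 1 - α := by linarith
  have h3 : 0 < 1 - p := by linarith
  rw [Real.norm_of_nonneg (by positivity), div_lt_one (by positivity)]
  nlinarith

lemma hasSum_gapWeight : HasSum (gapWeight p α) 1 := by
  have h1 : 0 < p := hα0.trans hαp
  have h2 : 0 < 1 - α := by linarith
  have h3 : 0 < p - α := by linarith
  have h := (hasSum_geometric_of_norm_lt_one (gapRatio_lt_one hα0 hαp hp1)).mul_left
    ((1 - α / p) * (α / (p * (1 - α))))
  have h4 : 1 - α * (1 - p) / (p * (1 - α)) = (p - α) / (p * (1 - α)) := by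
    field_simp
    ring
  have h5 : gapWeight p α 0 + (1 - α / p) * (α / (p * (1 - α))) *
      (1 - α * (1 - p) / (p * (1 - α)))⁻¹ = 1 := by
    rw [h4, gapWeight]
    field_simp
    ring
  exact h5 ▸ HasSum.zero_add (f := gapWeight p α) h

lemma hasSum_mul_gapWeight :
    HasSum (fun k : ℕ => gapWeight p α k * (k : ℝ)) (α * (1 - α) / (p - α)) := by
  have h1 : 0 < p := hα0.trans hαp
  have h2 : 0 < 1 - α := by linarith
  have h3 : 0 < p - α := by linarith
  have hr := gapRatio_lt_one hα0 hαp hp1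
  have h := ((hasSum_coe_mul_geometric_of_norm_lt_one hr).add
    (hasSum_geometric_of_norm_lt_one hr)).mul_left ((1 - α / p) * (α / (p * (1 - α))))
  have h4 : 1 - α * (1 - p) / (p * (1 - α)) = (p - α) / (p * (1 - α)) := by
    field_simp
    ring
  have h5 : gapWeight p α 0 * ((0 : ℕ) : ℝ) + (1 - α / p) * (α / (p * (1 - α))) *
      (α * (1 - p) / (p * (1 - α)) / (1 - α * (1 - p) / (p * (1 - α))) ^ 2 +
        (1 - α * (1 - p) / (p * (1 - α)))⁻¹) = α * (1 - α) / (p - α) := by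
    rw [h4]
    field_simp
    ring
  rw [← h5]
  refine HasSum.zero_add (f := fun k : ℕ => gapWeight p α k * (k : ℝ)) (h.congr_fun fun k => ?_)
  simp only [gapWeight]
  push_cast
  ring

lemma isProbabilityMeasure_gapLaw : IsProbabilityMeasure (gapLaw p α) := by
  constructor
  rw [gapLaw, Measure.sum_apply _ MeasurableSet.univ]
  simp only [Measure.smul_apply, measure_univ, smul_eq_mul, mul_one]
  have h := hasSum_gapWeight hα0 hαp hp1
  rw [← ENNReal.ofReal_tsum_of_nonneg (gapWeight_nonneg hα0 hαp hp1) h.summable, h.tsum_eq,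
    ENNReal.ofReal_one]

lemma integrable_gapLaw : Integrable (fun k : ℕ => (k : ℝ)) (gapLaw p α) := by
  refine integrable_sum_dirac (fun _ => ENNReal.ofReal_ne_top) ?_
  refine (hasSum_mul_gapWeight hα0 hαp hp1).summable.congr fun k => ?_
  rw [ENNReal.toReal_ofReal (gapWeight_nonneg hα0 hαp hp1 k)]
  simp

lemma integral_gapLaw : ∫ k : ℕ, (k : ℝ) ∂(gapLaw p α) = α * (1 - α) / (p - α) := by
  have := isProbabilityMeasure_gapLaw hα0 hαp hp1
  rw [integral_countable (integrable_gapLaw hα0 hαp hp1)]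
  simp only [Measure.real, gapLaw_singleton,
    ENNReal.toReal_ofReal (gapWeight_nonneg hα0 hαp hp1 _), smul_eq_mul]
  exact (hasSum_mul_gapWeight hα0 hαp hp1).tsum_eq

end

/-- A particle with `g` empty sites in front of it leaves its site. -/
def served (g : ℕ) (service : Bool) : Bool := service && decide (0 < g)

/-- The number of empty sites in front of a particle after one step. -/
def queueStep (g : ℕ) (arrival service : Bool) : ℕ :=
  g + arrival.toNat - (served g service).toNat

/-- Burke's property of one step of a queue: if the queue is stationary, then a departure has the
probability of an arrival, and it is independent of the queue that it leaves behind. -/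
theorem map_queueStep (p α : unitInterval) (hα0 : 0 < (α : ℝ)) (hαp : (α : ℝ) < p)
    (hp1 : (p : ℝ) < 1) :
    (((gapLaw p α).prod ((coin α).prod (coin p))).map
      fun q => (served q.1 q.2.2, queueStep q.1 q.2.1 q.2.2)) = (coin α).prod (gapLaw p α) := by
  have := isProbabilityMeasure_gapLaw hα0 hαp hp1
  have h1 : 0 < (p : ℝ) := hα0.trans hαp
  have h2 : 0 < 1 - (α : ℝ) := by linarith
  have hw1 : gapWeight p α 1 * (p * (1 - α)) = gapWeight p α 0 * α := by
    simp only [gapWeight, pow_zero]; field_simp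
  have hw2 : ∀ k, gapWeight p α (k + 2) * (p * (1 - α)) = gapWeight p α (k + 1) * (α * (1 - p)) := by
    intro k
    simp only [gapWeight, pow_succ]; field_simp
  set m := gapLaw p α with hm
  set Q := m.prod ((coin α).prod (coin p)) with hQ
  have hms : ∀ k, m.real {k} = gapWeight p α k := fun k => by
    rw [Measure.real, hm, gapLaw_singleton,
      ENNReal.toReal_ofReal (gapWeight_nonneg hα0 hαp hp1 _)]
  have hct : ∀ q : unitInterval, (coin q).real {true} = q := fun q => by
    simp
  have hcf : ∀ q : unitInterval, (coin q).real {false} = 1 - q := fun q => by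
    simp
  have hQs : ∀ g a s, Q.real {(g, a, s)} =
      gapWeight p α g * ((coin α).real {a} * (coin p).real {s}) := by
    intro g a s
    rw [← Set.singleton_prod_singleton, ← Set.singleton_prod_singleton, hQ,
      measureReal_prod_prod, measureReal_prod_prod, hms]
  have hmeas : Measurable fun q : ℕ × Bool × Bool =>
      (served q.1 q.2.2, queueStep q.1 q.2.1 q.2.2) := measurable_of_countable _
  have hfin : ∀ (F : Finset (ℕ × Bool × Bool)), Q.real F = ∑ x ∈ F, Q.real {x} := by
    intro F
    exact (sum_measureReal_singleton F).symm
  have hprob := Measure.isProbabilityMeasure_map (μ := Q) hmeas.aemeasurable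
  refine Measure.ext_of_singleton ?_
  rintro ⟨d, k⟩
  rw [← measureReal_eq_measureReal_iff, map_measureReal_apply hmeas (measurableSet_singleton _)]
  rw [← Set.singleton_prod_singleton (a := d), measureReal_prod_prod, hms]
  have hpre : ∀ (F : Finset (ℕ × Bool × Bool)),
      (∀ g a s, (served g s = d ∧ queueStep g a s = k) ↔ (g, a, s) ∈ F) →
      (fun q : ℕ × Bool × Bool => (served q.1 q.2.2, queueStep q.1 q.2.1 q.2.2)) ⁻¹'
        ({d} ×ˢ {k}) = (F : Set (ℕ × Bool × Bool)) := by
    intro F h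
    ext ⟨g, a, s⟩
    simpa using h g a s
  cases d with
  | false =>
    match k with
    | 0 =>
      rw [hpre {(0, false, true), (0, false, false)}, hfin]
      · simp [hQs, hct, hcf]
        ring
      · rintro (_ | g) (_ | _) (_ | _) <;> simp [served, queueStep]
    | 1 =>
      rw [hpre {(0, true, true), (0, true, false), (1, false, false)}, hfin]
      · simp [hQs, hct, hcf]
        linear_combination -hw1
      · rintro (_ | g) (_ | _) (_ | _) <;> simp [served, queueStep]
    | k + 2 =>
      rw [hpre {(k + 2, false, false), (k + 1, true, false)}, hfin]
      · simp [hQs, hct, hcf]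
        linear_combination -hw2 k
      · rintro (_ | g) (_ | _) (_ | _) <;> simp [served, queueStep]
  | true =>
    match k with
    | 0 =>
      rw [hpre {(1, false, true)}, hfin]
      · simp [hQs, hct, hcf]
        linear_combination hw1
      · rintro (_ | g) (_ | _) (_ | _) <;> simp [served, queueStep]
    | k + 1 =>
      rw [hpre {(k + 2, false, true), (k + 1, true, true)}, hfin]
      · simp [hQs, hct, hcf]
        linear_combination hw2 k
      · rintro (_ | g) (_ | _) (_ | _) <;> simp [served, queueStep]

/-! ### Departures from a queue and from a tandem of queues -/

/-- The number of empty sites in front of a particle at time `t`, where `A` records the jumps of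
the next particle and `S` the coins of the particle itself. -/
def queue (g : ℕ) (A S : ℕ → Bool) : ℕ → ℕ
  | 0 => g
  | t + 1 => queueStep (queue g A S t) (A t) (S t)

/-- The sequence of the jumps of a particle, see `queue`. -/
def departures (g : ℕ) (A S : ℕ → Bool) : ℕ → Bool :=
  fun t => served (queue g A S t) (S t)

lemma queue_cons (g : ℕ) (a s : Bool) (A S : ℕ → Bool) (t : ℕ) :
    queue g (cons a A) (cons s S) (t + 1) = queue (queueStep g a s) A S t := by
  induction t with
  | zero => rfl
  | succ t ih => rw [queue, ih]; rfl

lemma departures_cons (g : ℕ) (a s : Bool) (A S : ℕ → Bool) :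
    departures g (cons a A) (cons s S) = cons (served g s) (departures (queueStep g a s) A S) := by
  ext1 t
  cases t with
  | zero => rfl
  | succ t => simp only [departures, queue_cons, cons_succ]

/-- A departure at time `t` depends only on the arrivals before `t`. -/
lemma trunc_departures (n g : ℕ) (A S : ℕ → Bool) :
    trunc (n + 1) (departures g A S) = trunc (n + 1) (departures g (trunc n A) S) := by
  have h : ∀ t ≤ n, queue g A S t = queue g (trunc n A) S t := by
    intro t
    induction t with
    | zero => intro _; rfl
    | succ t ih =>
      intro ht
      simp only [queue]
      rw [ih (by omega), trunc, if_pos (by omega)]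
  ext1 t
  simp only [trunc]
  split_ifs with ht
  · simp only [departures]
    rw [h t (by omega)]
  · rfl

@[fun_prop]
lemma measurable_queue {Ω : Type*} [MeasurableSpace Ω] {g : Ω → ℕ} {A S : Ω → ℕ → Bool}
    (hg : Measurable g) (hA : Measurable A) (hS : Measurable S) (t : ℕ) :
    Measurable fun ω => queue (g ω) (A ω) (S ω) t := by
  induction t with
  | zero => exact hg
  | succ t ih =>
    have : Measurable fun x : ℕ × Bool × Bool => queueStep x.1 x.2.1 x.2.2 :=
      measurable_of_countable _
    exact this.comp (ih.prodMk (((measurable_pi_apply t).comp hA).prodMk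
      ((measurable_pi_apply t).comp hS)))

@[fun_prop]
lemma measurable_departures {Ω : Type*} [MeasurableSpace Ω] {g : Ω → ℕ} {A S : Ω → ℕ → Bool}
    (hg : Measurable g) (hA : Measurable A) (hS : Measurable S) :
    Measurable fun ω => departures (g ω) (A ω) (S ω) := by
  refine measurable_pi_lambda _ fun t => ?_
  have : Measurable fun x : ℕ × Bool => served x.1 x.2 := measurable_of_countable _
  exact this.comp ((measurable_queue hg hA hS t).prodMk ((measurable_pi_apply t).comp hS))

lemma measurePreserving_prodProdProdComm {X Y Z W : Type*} [MeasurableSpace X] [MeasurableSpace Y]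
    [MeasurableSpace Z] [MeasurableSpace W] (a : Measure X) (b : Measure Y) (c : Measure Z)
    (d : Measure W) [SFinite a] [SFinite b] [SFinite c] [SFinite d] :
    MeasurePreserving (fun q : (X × Y) × (Z × W) => ((q.1.1, q.2.1), (q.1.2, q.2.2)))
      ((a.prod b).prod (c.prod d)) ((a.prod c).prod (b.prod d)) := by
  have h1 := measurePreserving_prodAssoc a b (c.prod d)
  have h2 := (MeasurePreserving.id a).prod
    ((measurePreserving_prodAssoc b c d).symm MeasurableEquiv.prodAssoc)
  have h3 := (MeasurePreserving.id a).prod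
    ((Measure.measurePreserving_swap (μ := b) (ν := c)).prod (MeasurePreserving.id d))
  have h4 := (MeasurePreserving.id a).prod (measurePreserving_prodAssoc c b d)
  have h5 := (measurePreserving_prodAssoc a c (b.prod d)).symm MeasurableEquiv.prodAssoc
  exact h5.comp (h4.comp (h3.comp (h2.comp h1)))

lemma measurePreserving_cons {B : Type*} [MeasurableSpace B] (β : Measure B)
    [IsProbabilityMeasure β] :
    MeasurePreserving (fun q : B × (ℕ → B) => cons q.1 q.2)
      (β.prod (Measure.infinitePi fun _ : ℕ => β)) (Measure.infinitePi fun _ => β) :=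
  ⟨by fun_prop, map_cons_infinitePi β⟩

/-- The law of a sequence of independent coins that show `true` with probability `p`. -/
noncomputable abbrev coinSeq (p : unitInterval) : Measure (ℕ → Bool) :=
  Measure.infinitePi fun _ => coin p

/-- Burke's theorem: the departures of a stationary queue have the law of the arrivals. -/
theorem map_departures (p α : unitInterval) (hα0 : 0 < (α : ℝ)) (hαp : (α : ℝ) < p)
    (hp1 : (p : ℝ) < 1) :
    (((gapLaw p α).prod ((coinSeq α).prod (coinSeq p))).map
      fun q => departures q.1 q.2.1 q.2.2) = coinSeq α := by
  have := isProbabilityMeasure_gapLaw hα0 hαp hp1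
  set dep : ℕ × (ℕ → Bool) × (ℕ → Bool) → ℕ → Bool := fun q => departures q.1 q.2.1 q.2.2
  have hdep : Measurable dep := by fun_prop
  set M := (gapLaw p α).prod ((coinSeq α).prod (coinSeq p))
  have := Measure.isProbabilityMeasure_map (μ := M) hdep.aemeasurable
  refine eq_of_causal_recursion (coin α) (fun q => cons q.1 q.2) (by fun_prop) ?_ ?_
    (map_cons_infinitePi _)
  · intro n e s
    ext1 t
    cases t <;> simp [trunc]
  · -- Both sides are the law of the departures when the first arrival and the first service are
    -- split off.
    have h1 : MeasurePreserving
        (Prod.map id (fun q : (Bool × Bool) × ((ℕ → Bool) × (ℕ → Bool)) =>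
          (cons q.1.1 q.2.1, cons q.1.2 q.2.2)))
        ((gapLaw p α).prod (((coin α).prod (coin p)).prod ((coinSeq α).prod (coinSeq p)))) M :=
      (MeasurePreserving.id _).prod
        (((measurePreserving_cons (coin α)).prod (measurePreserving_cons (coin p))).comp
          (measurePreserving_prodProdProdComm _ _ _ _))
    have hstep : MeasurePreserving (fun q : ℕ × Bool × Bool =>
        (served q.1 q.2.2, queueStep q.1 q.2.1 q.2.2))
        ((gapLaw p α).prod ((coin α).prod (coin p))) ((coin α).prod (gapLaw p α)) :=
      ⟨measurable_of_countable _, map_queueStep p α hα0 hαp hp1⟩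
    have h2 := (measurePreserving_prodAssoc (coin α) (gapLaw p α)
      ((coinSeq α).prod (coinSeq p))).comp
      ((hstep.prod (MeasurePreserving.id ((coinSeq α).prod (coinSeq p)))).comp
        ((measurePreserving_prodAssoc (gapLaw p α) ((coin α).prod (coin p))
          ((coinSeq α).prod (coinSeq p))).symm MeasurableEquiv.prodAssoc))
    have hD : MeasurePreserving dep M (M.map dep) := ⟨hdep, rfl⟩
    have h3 := (MeasurePreserving.id (coin α)).prod hD
    rw [← (h3.comp h2).map_eq, Measure.map_map (by fun_prop) (h3.comp h2).measurable,
      ← (hD.comp h1).map_eq]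
    congr 1
    ext1 q
    exact (departures_cons _ _ _ _ _).symm

/-- The number of empty sites in front of the particle `k` at time `t`, in the system of the
particles `0, 1, 2, …` with initial gaps `g` and with the coins `c k t`. -/
def gaps (g : ℕ → ℕ) (c : ℕ → ℕ → Bool) : ℕ → ℕ → ℕ
  | 0 => g
  | t + 1 => fun k =>
      queueStep (gaps g c t k) (served (gaps g c t (k + 1)) (c (k + 1) t)) (c k t)

/-- The sequence of the jumps of the particle `0`, see `gaps`. -/
def firstJumps (g : ℕ → ℕ) (c : ℕ → ℕ → Bool) : ℕ → Bool :=
  fun t => served (gaps g c t 0) (c 0 t)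

lemma gaps_cons_succ (g₀ : ℕ) (g : ℕ → ℕ) (c₀ : ℕ → Bool) (c : ℕ → ℕ → Bool) (t k : ℕ) :
    gaps (cons g₀ g) (cons c₀ c) t (k + 1) = gaps g c t k := by
  induction t generalizing k with
  | zero => rfl
  | succ t ih => simp only [gaps, ih, cons_succ]

lemma firstJumps_cons (g₀ : ℕ) (g : ℕ → ℕ) (c₀ : ℕ → Bool) (c : ℕ → ℕ → Bool) :
    firstJumps (cons g₀ g) (cons c₀ c) = departures g₀ (firstJumps g c) c₀ := by
  have h : ∀ t, gaps (cons g₀ g) (cons c₀ c) t 0 = queue g₀ (firstJumps g c) c₀ t := by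
    intro t
    induction t with
    | zero => rfl
    | succ t ih => simp only [gaps, queue, ih, gaps_cons_succ, cons_succ, cons_zero, firstJumps]
  ext1 t
  simp only [firstJumps, departures, h, cons_zero]

lemma measurable_gaps (t k : ℕ) :
    Measurable fun q : (ℕ → ℕ) × (ℕ → ℕ → Bool) => gaps q.1 q.2 t k := by
  induction t generalizing k with
  | zero => exact (measurable_pi_apply k).comp measurable_fst
  | succ t ih =>
    have h1 : Measurable fun x : ℕ × Bool × Bool => queueStep x.1 x.2.1 x.2.2 :=
      measurable_of_countable _
    have h2 : Measurable fun x : ℕ × Bool => served x.1 x.2 := measurable_of_countable _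
    have h3 : ∀ k, Measurable fun q : (ℕ → ℕ) × (ℕ → ℕ → Bool) => q.2 k t := fun k => by fun_prop
    exact h1.comp ((ih k).prodMk ((h2.comp ((ih (k + 1)).prodMk (h3 (k + 1)))).prodMk (h3 k)))

lemma measurable_firstJumps :
    Measurable fun q : (ℕ → ℕ) × (ℕ → ℕ → Bool) => firstJumps q.1 q.2 := by
  refine measurable_pi_lambda _ fun t => ?_
  have h2 : Measurable fun x : ℕ × Bool => served x.1 x.2 := measurable_of_countable _
  have h3 : Measurable fun q : (ℕ → ℕ) × (ℕ → ℕ → Bool) => q.2 0 t := by fun_prop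
  exact h2.comp ((measurable_gaps t 0).prodMk h3)

/-- In the stationary system the jumps of a particle are independent coins. -/
theorem map_firstJumps (p α : unitInterval) (hα0 : 0 < (α : ℝ)) (hαp : (α : ℝ) < p)
    (hp1 : (p : ℝ) < 1) :
    (((Measure.infinitePi fun _ : ℕ => gapLaw p α).prod
      (Measure.infinitePi fun _ : ℕ => coinSeq p)).map fun q => firstJumps q.1 q.2) =
      coinSeq α := by
  have := isProbabilityMeasure_gapLaw hα0 hαp hp1
  set M := (Measure.infinitePi fun _ : ℕ => gapLaw p α).prod
    (Measure.infinitePi fun _ : ℕ => coinSeq p)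
  have hD : MeasurePreserving (fun q : (ℕ → ℕ) × (ℕ → ℕ → Bool) => firstJumps q.1 q.2) M
    (M.map fun q => firstJumps q.1 q.2) := ⟨measurable_firstJumps, rfl⟩
  have := Measure.isProbabilityMeasure_map (μ := M) measurable_firstJumps.aemeasurable
  refine eq_of_causal_recursion ((gapLaw p α).prod (coinSeq p))
    (fun q => departures q.1.1 q.2 q.1.2) (by fun_prop) ?_ ?_ ?_
  · exact fun n e s => trunc_departures n e.1 s e.2
  · -- The particle `0` is driven by the system of the particles `1, 2, …`.
    have h1 := ((measurePreserving_cons (gapLaw p α)).prod (measurePreserving_cons (coinSeq p))).comp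
      (measurePreserving_prodProdProdComm (gapLaw p α) (coinSeq p)
        (Measure.infinitePi fun _ : ℕ => gapLaw p α) (Measure.infinitePi fun _ : ℕ => coinSeq p))
    have h2 := (MeasurePreserving.id ((gapLaw p α).prod (coinSeq p))).prod hD
    conv_rhs => rw [← (hD.comp h1).map_eq]
    rw [← h2.map_eq, Measure.map_map (by fun_prop) h2.measurable]
    congr 1
    ext1 q
    exact (firstJumps_cons _ _ _ _).symm
  · have h1 := ((MeasurePreserving.id (gapLaw p α)).prod
      (Measure.measurePreserving_swap (μ := coinSeq p) (ν := coinSeq α))).comp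
        (measurePreserving_prodAssoc (gapLaw p α) (coinSeq p) (coinSeq α))
    have h2 : MeasurePreserving (fun q : ℕ × (ℕ → Bool) × (ℕ → Bool) => departures q.1 q.2.1 q.2.2)
        ((gapLaw p α).prod ((coinSeq α).prod (coinSeq p))) (coinSeq α) :=
      ⟨by fun_prop, map_departures p α hα0 hαp hp1⟩
    exact (h2.comp h1).map_eq

/-! ### A configuration with a prescribed velocity -/

lemma ae_tendsto_average_infinitePi {X : Type*} [MeasurableSpace X] (β : Measure X)
    [IsProbabilityMeasure β] {f : X → ℝ} (hf : Measurable f) (hi : Integrable f β) :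
    ∀ᵐ s ∂(Measure.infinitePi fun _ : ℕ => β),
      Tendsto (fun n : ℕ => (∑ j ∈ Finset.range n, f (s j)) / n) atTop (𝓝 (∫ x, f x ∂β)) := by
  have hev : ∀ j, MeasurePreserving (fun s : ℕ → X => s j)
      (Measure.infinitePi fun _ : ℕ => β) β := fun j => measurePreserving_eval_infinitePi _ j
  have h := strong_law_ae_real (μ := Measure.infinitePi fun _ : ℕ => β)
    (fun j s => f (s j)) ((hev 0).integrable_comp_of_integrable hi)
    (fun j k hjk => (iIndepFun_infinitePi (P := fun _ : ℕ => β) (X := fun _ => f)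
      fun _ => hf).indepFun hjk)
    (fun j => by
      refine ⟨(hf.comp (measurable_pi_apply j)).aemeasurable,
        (hf.comp (measurable_pi_apply 0)).aemeasurable, ?_⟩
      have h1 : ∀ j, (Measure.infinitePi fun _ : ℕ => β).map (fun s => f (s j)) = β.map f := by
        intro j
        rw [← (hev j).map_eq, Measure.map_map hf (hev j).measurable, (hev j).map_eq]
        rfl
      rw [h1, h1])
  have h2 : ∫ s, f (s 0) ∂(Measure.infinitePi fun _ : ℕ => β) = ∫ x, f x ∂β := by
    conv_rhs => rw [← (hev 0).map_eq]
    rw [integral_map (hev 0).measurable.aemeasurable hf.aestronglyMeasurable]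
  rw [h2] at h
  exact h

/-- There are gaps `g` of mean `α (1 - α) / (p - α)` such that a particle that has these gaps in
front of it almost surely moves with velocity `α`. -/
lemma exists_gaps (p α : unitInterval) (hα0 : 0 < (α : ℝ)) (hαp : (α : ℝ) < p)
    (hp1 : (p : ℝ) < 1) :
    ∃ g : ℕ → ℕ,
      Tendsto (fun n : ℕ => (∑ j ∈ Finset.range n, (g j : ℝ)) / n) atTop
        (𝓝 (α * (1 - α) / (p - α))) ∧
      ∀ᵐ c ∂(Measure.infinitePi fun _ : ℕ => coinSeq p),
        Tendsto (fun t : ℕ => (∑ s ∈ Finset.range t, ((firstJumps g c s).toNat : ℝ)) / t) atTop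
          (𝓝 α) := by
  have := isProbabilityMeasure_gapLaw hα0 hαp hp1
  have hD : MeasurePreserving (fun q : (ℕ → ℕ) × (ℕ → ℕ → Bool) => firstJumps q.1 q.2)
      ((Measure.infinitePi fun _ : ℕ => gapLaw p α).prod
        (Measure.infinitePi fun _ : ℕ => coinSeq p)) (coinSeq α) :=
    ⟨measurable_firstJumps, map_firstJumps p α hα0 hαp hp1⟩
  have h1 := ae_tendsto_average_infinitePi (gapLaw p α) (f := fun k => (k : ℝ))
    (measurable_of_countable _) (integrable_gapLaw hα0 hαp hp1)
  rw [integral_gapLaw hα0 hαp hp1] at h1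
  have h2 := ae_tendsto_average_infinitePi (coin α) (f := fun b => (b.toNat : ℝ))
    (measurable_of_countable _) Integrable.of_finite
  have hint : ∫ b : Bool, (b.toNat : ℝ) ∂(coin α) = α := by
    simp [integral_bernoulliMeasure]
  rw [hint] at h2
  have h3 := Measure.ae_ae_of_ae_prod (hD.quasiMeasurePreserving.ae h2)
  obtain ⟨g, hg1, hg2⟩ := (h1.and h3).exists
  exact ⟨g, hg1, hg2⟩

/-- The configuration with the particle `i` at the origin, with `g k` empty sites between the
particles `i + k` and `i + k + 1`, and with no empty sites between the particles up to `i`. -/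
def spaced (i : ℤ) (g : ℕ → ℕ) : ℤ → ℤ :=
  fun n => n - i + ∑ j ∈ Finset.range (n - i).toNat, (g j : ℤ)

lemma spaced_add (i : ℤ) (g : ℕ → ℕ) (k : ℕ) :
    spaced i g (i + k) = k + ∑ j ∈ Finset.range k, (g j : ℤ) := by
  simp [spaced]

lemma trajectory_spaced (i : ℤ) (g : ℕ → ℕ) (ω : ℕ × ℤ → Bool) (t : ℕ) :
    (∀ k : ℕ, trajectory (spaced i g) ω t (i + k + 1) = trajectory (spaced i g) ω t (i + k) + 1 +
      gaps g (fun k t => ω (t, i + k)) t k) ∧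
    trajectory (spaced i g) ω t i =
      ∑ s ∈ Finset.range t, ((firstJumps g (fun k t => ω (t, i + k)) s).toNat : ℤ) := by
  -- A jump moves a particle if and only if there is an empty site in front of it.
  have hstep : ∀ (x : ℤ → ℤ) (c : ℤ → Bool) (k : ℤ) (n : ℕ), x (k + 1) = x k + 1 + n →
      step c x k = x k + ((served n (c k)).toNat : ℤ) := by
    intro x c k n h
    unfold step served
    rw [h]
    cases c k <;> rcases n with _ | n <;> simp
  induction t with
  | zero =>
    refine ⟨fun k => ?_, by simp [trajectory, spaced]⟩
    have h1 := spaced_add i g (k + 1)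
    rw [Nat.cast_add, Nat.cast_one, ← add_assoc] at h1
    simp only [trajectory, gaps]
    rw [h1, spaced_add, Finset.sum_range_succ]
    ring
  | succ t ih =>
    obtain ⟨ih1, ih2⟩ := ih
    have h0 : ∀ k : ℕ, trajectory (spaced i g) ω (t + 1) (i + k) =
        trajectory (spaced i g) ω t (i + k) +
          ((served (gaps g (fun k t => ω (t, i + k)) t k) (ω (t, i + k))).toNat : ℤ) :=
      fun k => hstep _ (fun j => ω (t, j)) (i + k) _ (ih1 k)
    constructor
    · intro k
      have h1 := h0 (k + 1)
      have h2 := ih1 k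
      rw [Nat.cast_add, Nat.cast_one, ← add_assoc] at h1
      rw [h1, h2, h0 k]
      simp only [gaps, queueStep]
      have h3 : (served (gaps g (fun k t => ω (t, i + k)) t k) (ω (t, i + k))).toNat ≤
          gaps g (fun k t => ω (t, i + k)) t k := by
        unfold served
        rcases gaps g (fun k t => ω (t, i + k)) t k with _ | n <;> cases ω (t, i + k) <;> simp
      push_cast
      rw [Nat.cast_sub (by omega)]
      push_cast
      simp only [← add_assoc]
      ring
    · have h1 := h0 0
      simp only [Nat.cast_zero, add_zero] at h1
      rw [h1, ih2, Finset.sum_range_succ]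
      simp [firstJumps]

lemma measurePreserving_coins (p : unitInterval) (i : ℤ) :
    MeasurePreserving (fun (ω : ℕ × ℤ → Bool) (k t : ℕ) => ω (t, i + k)) (coins (ℕ × ℤ) p)
      (Measure.infinitePi fun _ : ℕ => coinSeq p) := by
  refine ⟨by fun_prop, ?_⟩
  have hf : Function.Injective fun q : ℕ × ℕ => ((q.2, i + (q.1 : ℤ)) : ℕ × ℤ) := by
    rintro ⟨a, b⟩ ⟨c, d⟩ h
    simp only [Prod.mk.injEq, add_right_inj, Nat.cast_inj] at h
    rw [h.1, h.2]
  have h1 := Measure.map_infinitePi_infinitePi_of_inj (P := fun _ : ℕ × ℤ => coin p) hf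
  have h2 := Measure.infinitePi_map_curry (fun _ _ : ℕ => coin p)
  rw [← h2, ← h1, Measure.map_map (by fun_prop) (by fun_prop)]
  rfl

/-- For every `α` in `(0, p)` there is a deterministic configuration whose mean spacing is
`1 + α (1 - α) / (p - α)` and whose particles almost surely have the velocity `α`. -/
lemma exists_spaced_velocity (p α : unitInterval) (hα0 : 0 < (α : ℝ)) (hαp : (α : ℝ) < p)
    (hp1 : (p : ℝ) < 1) (i : ℤ) :
    ∃ y : ℤ → ℤ, Tendsto (fun n : ℕ => (y (i + n) : ℝ) / n) atTop
        (𝓝 (1 + α * (1 - α) / (p - α))) ∧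
      ∀ᵐ ω ∂(coins (ℕ × ℤ) p), Tendsto (averageVelocity y ω i) atTop (𝓝 α) := by
  obtain ⟨g, hg1, hg2⟩ := exists_gaps p α hα0 hαp hp1
  refine ⟨spaced i g, ?_, ?_⟩
  · refine (hg1.const_add 1).congr' ?_
    filter_upwards [eventually_gt_atTop 0] with n hn
    have : (n : ℝ) ≠ 0 := by positivity
    rw [spaced_add]
    push_cast
    field_simp
  · filter_upwards [(measurePreserving_coins p i).quasiMeasurePreserving.ae hg2] with ω hω
    refine hω.congr fun t => ?_
    rw [averageVelocity, (trajectory_spaced i g ω t).2]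
    simp [spaced]

/-! ### Comparison with an arbitrary configuration -/

/-- The dynamics preserves the order of labelled configurations, and the motion of a particle
depends only on the particles in front of it. -/
lemma trajectory_le {x y : ℤ → ℤ} {i C : ℤ} (h : ∀ k : ℕ, x (i + k) ≤ y (i + k) + C)
    (ω : ℕ × ℤ → Bool) (t k : ℕ) :
    trajectory x ω t (i + k) ≤ trajectory y ω t (i + k) + C := by
  induction t generalizing k with
  | zero => exact h k
  | succ t ih =>
    have h1 := ih k
    have h2 := ih (k + 1)
    rw [Nat.cast_add, Nat.cast_one, ← add_assoc] at h2
    simp only [trajectory, step]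
    split_ifs <;> omega

lemma admissible_trajectory {x : ℤ → ℤ} (hx : Admissible x) (ω : ℕ × ℤ → Bool) (t : ℕ) :
    Admissible (trajectory x ω t) := by
  induction t with
  | zero => exact hx
  | succ t ih =>
    intro i
    have h1 := ih i
    have h2 := ih (i + 1)
    simp only [trajectory, step]
    split_ifs <;> omega

lemma averageVelocity_nonneg {x : ℤ → ℤ} (hx : Admissible x) (ω : ℕ × ℤ → Bool) (i : ℤ)
    (t : ℕ) : 0 ≤ averageVelocity x ω i t := by
  have h : x i ≤ trajectory x ω t i := by
    induction t with
    | zero => exact le_rfl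
    | succ t ih =>
      have h1 := admissible_trajectory hx ω t i
      simp only [trajectory, step]
      split_ifs <;> omega
  have h' : (x i : ℝ) ≤ trajectory x ω t i := by exact_mod_cast h
  exact div_nonneg (sub_nonneg.2 h') (Nat.cast_nonneg t)

lemma tendsto_div_of_hasDensity {x : ℤ → ℤ} {ρ : ℝ} (hρ : 0 < ρ) (hx : HasDensity x ρ) (i : ℤ) :
    Tendsto (fun n : ℕ => (x (i + n) : ℝ) / n) atTop (𝓝 ρ⁻¹) := by
  have h1 := hx.inv₀ hρ.ne'
  have ht : Tendsto (fun n : ℕ => (i + n + 1).toNat) atTop atTop := by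
    refine tendsto_atTop.2 fun b => ?_
    filter_upwards [eventually_ge_atTop (b + i.natAbs)] with n hn
    omega
  have h2 := h1.comp ht
  have h3 : Tendsto (fun n : ℕ => ((i : ℝ) + 1) / n) atTop (𝓝 0) :=
    tendsto_const_div_atTop_nhds_zero_nat _
  have h4 : Tendsto (fun n : ℕ => (x 0 : ℝ) / n) atTop (𝓝 0) :=
    tendsto_const_div_atTop_nhds_zero_nat _
  have h5 := (h2.mul (h3.const_add 1)).add h4
  simp only [add_zero, mul_one] at h5
  refine h5.congr' ?_
  filter_upwards [eventually_gt_atTop (i.natAbs + 1)] with n hn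
  have hn0 : (n : ℝ) ≠ 0 := by
    have : 0 < n := by omega
    positivity
  have hc : (((i + n + 1).toNat : ℕ) : ℤ) = i + n + 1 := by omega
  have hcr : (((i + n + 1).toNat : ℕ) : ℝ) = i + n + 1 := by exact_mod_cast hc
  have hpos : (i : ℝ) + n + 1 ≠ 0 := by
    have : i + n + 1 ≠ 0 := by omega
    exact_mod_cast this
  simp only [Function.comp_apply, hcr, hc, inv_div]
  rw [show i + (n : ℤ) + 1 - 1 = i + n by ring]
  field_simp
  ring

lemma exists_le_add_of_tendsto {u v : ℕ → ℤ} {a b : ℝ}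
    (hu : Tendsto (fun n : ℕ => (u n : ℝ) / n) atTop (𝓝 a))
    (hv : Tendsto (fun n : ℕ => (v n : ℝ) / n) atTop (𝓝 b)) (hab : a < b) :
    ∃ C : ℤ, ∀ n, u n ≤ v n + C := by
  obtain ⟨N, hN⟩ := eventually_atTop.1 ((hu.eventually_lt hv hab).and (eventually_gt_atTop 0))
  refine ⟨∑ n ∈ Finset.range N, |u n - v n|, fun n => ?_⟩
  have hnn : ∀ n ∈ Finset.range N, 0 ≤ |u n - v n| := fun n _ => abs_nonneg _
  rcases lt_or_ge n N with h | h
  · have h1 := Finset.single_le_sum hnn (Finset.mem_range.2 h)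
    have h2 := le_abs_self (u n - v n)
    omega
  · obtain ⟨h1, h2⟩ := hN n h
    have h3 : (0 : ℝ) < n := by exact_mod_cast h2
    rw [div_lt_div_iff_of_pos_right h3] at h1
    have h4 : u n < v n := by exact_mod_cast h1
    have h5 := Finset.sum_nonneg hnn
    omega

lemma averageVelocity_le {x y : ℤ → ℤ} {i C : ℤ} (h : ∀ k : ℕ, x (i + k) ≤ y (i + k) + C)
    (ω : ℕ × ℤ → Bool) (t : ℕ) :
    averageVelocity x ω i t ≤ averageVelocity y ω i t + ((y i : ℝ) - x i + C) / t := by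
  have h1 := trajectory_le h ω t 0
  simp only [Nat.cast_zero, add_zero] at h1
  have h2 : (trajectory x ω t i : ℝ) ≤ trajectory y ω t i + C := by exact_mod_cast h1
  rw [averageVelocity, averageVelocity, ← add_div]
  exact div_le_div_of_nonneg_right (by linarith) (Nat.cast_nonneg t)

section Velocity

variable {p ρ : ℝ} (hp0 : 0 < p) (hp1 : p < 1) (hρ0 : 0 < ρ) (hρ1 : ρ ≤ 1)

/-- The velocity `V(ρ)` of a configuration of density `ρ`. -/
noncomputable def velocity (p ρ : ℝ) : ℝ := (1 - √(1 - 4 * p * ρ * (1 - ρ))) / (2 * ρ)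

include hp0 hp1 hρ0 hρ1

lemma velocity_spec : 0 ≤ velocity p ρ ∧ velocity p ρ < p ∧ 2 * ρ * velocity p ρ ≤ 1 ∧
    ρ * velocity p ρ ^ 2 - velocity p ρ + p * (1 - ρ) = 0 := by
  have hD : 0 ≤ 1 - 4 * p * ρ * (1 - ρ) := by
    have h1 : 0 ≤ ρ * (1 - ρ) := mul_nonneg hρ0.le (by linarith)
    nlinarith [sq_nonneg (1 - 2 * ρ)]
  have hs := Real.sq_sqrt hD
  have hs0 := Real.sqrt_nonneg (1 - 4 * p * ρ * (1 - ρ))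
  have hs1 : √(1 - 4 * p * ρ * (1 - ρ)) ≤ 1 := by
    rw [Real.sqrt_le_one]
    have : 0 ≤ p * ρ * (1 - ρ) := mul_nonneg (by positivity) (by linarith)
    linarith
  have hs2 : 1 - 2 * ρ * p < √(1 - 4 * p * ρ * (1 - ρ)) := by
    refine Real.lt_sqrt_of_sq_lt ?_
    have : 0 < p * ρ ^ 2 * (1 - p) := mul_pos (by positivity) (by linarith)
    nlinarith
  have hv : 2 * ρ * velocity p ρ = 1 - √(1 - 4 * p * ρ * (1 - ρ)) := by
    unfold velocity; field_simp
  set s := √(1 - 4 * p * ρ * (1 - ρ))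
  refine ⟨?_, ?_, by linarith, ?_⟩
  · exact div_nonneg (by linarith) (by linarith)
  · nlinarith
  · have h4 : 4 * ρ * (ρ * velocity p ρ ^ 2 - velocity p ρ + p * (1 - ρ)) = 0 := by
      have : s = 1 - 2 * ρ * velocity p ρ := by linarith
      rw [this] at hs
      linarith
    exact (mul_eq_zero.1 h4).resolve_left (by positivity)

lemma inv_lt_spacing {α : ℝ} (h1 : velocity p ρ < α) (h2 : α < p) :
    ρ⁻¹ < 1 + α * (1 - α) / (p - α) := by
  obtain ⟨hv0, hvp, -, hv⟩ := velocity_spec hp0 hp1 hρ0 hρ1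
  set v := velocity p ρ
  have h3 : 0 < p - α := by linarith
  have h4 : ρ * (p + v) < 1 := by
    have : (p - v) * (ρ * (p + v) - 1) = -(p * ρ * (1 - p)) := by linear_combination -hv
    have h5 : 0 < p * ρ * (1 - p) := mul_pos (by positivity) (by linarith)
    by_contra! h6
    nlinarith
  have h5 : ρ * (α + v) < 1 := by nlinarith
  rw [inv_lt_iff_one_lt_mul₀ hρ0]
  have h6 : (1 + α * (1 - α) / (p - α)) * ρ - 1 = (α - v) * (1 - ρ * (α + v)) / (p - α) := by
    field_simp
    linear_combination -hv
  have h7 : 0 < (α - v) * (1 - ρ * (α + v)) / (p - α) :=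
    div_pos (mul_pos (by linarith) (by linarith)) h3
  linarith

lemma spacing_lt_inv {α : ℝ} (h1 : α < velocity p ρ) :
    1 + α * (1 - α) / (p - α) < ρ⁻¹ := by
  obtain ⟨hv0, hvp, hv2, hv⟩ := velocity_spec hp0 hp1 hρ0 hρ1
  set v := velocity p ρ
  have h3 : 0 < p - α := by linarith
  have h5 : ρ * (α + v) < 1 := by nlinarith
  rw [← one_div, lt_div_iff₀ hρ0]
  have h6 : (1 + α * (1 - α) / (p - α)) * ρ - 1 = -((v - α) * (1 - ρ * (α + v)) / (p - α)) := by
    field_simp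
    linear_combination -hv
  have h7 : 0 < (v - α) * (1 - ρ * (α + v)) / (p - α) :=
    div_pos (mul_pos (by linarith) (by linarith)) h3
  linarith

end Velocity

/-- The law of large numbers: a configuration of density `ρ` has the velocity `V(ρ)`, because it
lies between configurations of slightly smaller and slightly larger velocity. -/
theorem hasVelocity {p : unitInterval} (hp0 : 0 < (p : ℝ)) (hp1 : (p : ℝ) < 1) {ρ : ℝ}
    (hρ0 : 0 < ρ) (hρ1 : ρ ≤ 1) {x : ℤ → ℤ} (hx : Admissible x) (hd : HasDensity x ρ) :
    HasVelocity p x (velocity p ρ) := by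
  obtain ⟨hv0, hvp, -, -⟩ := velocity_spec hp0 hp1 hρ0 hρ1
  refine ae_all_iff.2 fun i => ?_
  have hxi := tendsto_div_of_hasDensity hρ0 hd i
  have hupper : ∀ᵐ ω ∂(coins (ℕ × ℤ) p), ∀ q : ℚ, velocity p ρ < q →
      ∀ᶠ t in atTop, averageVelocity x ω i t < q := by
    refine ae_all_iff.2 fun q => ?_
    by_cases hq : velocity p ρ < q
    swap
    · exact Eventually.of_forall fun ω h => absurd h hq
    obtain ⟨α, hα1, hα2⟩ := exists_between (lt_min hq hvp)
    have hαp : α < p := hα2.trans_le (min_le_right _ _)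
    obtain ⟨y, hy1, hy2⟩ := exists_spaced_velocity p ⟨α, by linarith, by linarith⟩
      (hv0.trans_lt hα1) hαp hp1 i
    obtain ⟨C, hC⟩ := exists_le_add_of_tendsto hxi hy1 (inv_lt_spacing hp0 hp1 hρ0 hρ1 hα1 hαp)
    filter_upwards [hy2] with ω hω _
    have h1 := hω.add (tendsto_const_div_atTop_nhds_zero_nat ((y i : ℝ) - x i + C))
    rw [add_zero] at h1
    filter_upwards [h1.eventually_lt_const (hα2.trans_le (min_le_left _ _))] with t ht
    exact (averageVelocity_le hC ω t).trans_lt ht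
  have hlower : ∀ᵐ ω ∂(coins (ℕ × ℤ) p), ∀ q : ℚ, q < velocity p ρ →
      ∀ᶠ t in atTop, q < averageVelocity x ω i t := by
    refine ae_all_iff.2 fun q => ?_
    by_cases hq : q < velocity p ρ
    swap
    · exact Eventually.of_forall fun ω h => absurd h hq
    rcases lt_or_ge (q : ℝ) 0 with hq0 | hq0
    · exact Eventually.of_forall fun ω _ => Eventually.of_forall fun t =>
        hq0.trans_le (averageVelocity_nonneg hx ω i t)
    obtain ⟨α, hα1, hα2⟩ := exists_between hq
    obtain ⟨y, hy1, hy2⟩ := exists_spaced_velocity p ⟨α, by linarith, by linarith⟩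
      (hq0.trans_lt hα1) (hα2.trans hvp) hp1 i
    obtain ⟨C, hC⟩ := exists_le_add_of_tendsto hy1 hxi (spacing_lt_inv hp0 hp1 hρ0 hρ1 hα2)
    filter_upwards [hy2] with ω hω _
    have h1 := hω.sub (tendsto_const_div_atTop_nhds_zero_nat ((x i : ℝ) - y i + C))
    rw [sub_zero] at h1
    filter_upwards [h1.eventually_const_lt hα1] with t ht
    have := averageVelocity_le hC ω t
    linarith
  filter_upwards [hupper, hlower] with ω h1 h2
  refine tendsto_order.2 ⟨fun a ha => ?_, fun a ha => ?_⟩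
  · obtain ⟨q, hq1, hq2⟩ := exists_rat_btwn ha
    exact (h2 q hq2).mono fun t ht => hq1.trans ht
  · obtain ⟨q, hq1, hq2⟩ := exists_rat_btwn ha
    exact (h1 q hq1).mono fun t ht => ht.trans hq2

/-! ### Cylinders and the Markov property -/

/-- The word that `η` reads at the sites `k, …, k + n`. -/
def word (k : ℤ) (n : ℕ) (η : ℤ → Fin 2) : Fin (n + 1) → Fin 2 := fun j => η (k + (j : ℕ))

/-- The configurations that read `a 0, …, a n` at the sites `k, …, k + n`. -/
def cylinderSet (k : ℤ) (n : ℕ) (a : ℕ → Fin 2) : Set (ℤ → Fin 2) :=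
  {η | ∀ j : ℕ, j ≤ n → η (k + (j : ℤ)) = a j}

@[fun_prop]
lemma measurable_word (k : ℤ) (n : ℕ) : Measurable (word k n) := by
  unfold word
  fun_prop

lemma word_preimage_singleton (k : ℤ) (n : ℕ) (a : ℕ → Fin 2) :
    word k n ⁻¹' {fun j : Fin (n + 1) => a j} = cylinderSet k n a := by
  ext η
  simp only [Set.mem_preimage, Set.mem_singleton_iff, cylinderSet, Set.mem_ofPred_eq]
  constructor
  · exact fun h j hj => congr_fun h ⟨j, Nat.lt_succ_of_le hj⟩
  · exact fun h => funext fun j => h j (Nat.le_of_lt_succ j.2)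

lemma exists_eq_word {n : ℕ} (w : Fin (n + 1) → Fin 2) (e : Fin 2) :
    ∃ a : ℕ → Fin 2, w = (fun j : Fin (n + 1) => a j) ∧ a (n + 1) = e :=
  ⟨fun j => if h : j < n + 1 then w ⟨j, h⟩ else e, by
    ext1 j
    dsimp only
    rw [dif_pos j.2], by simp⟩

lemma measurableSet_cylinderSet (k : ℤ) (n : ℕ) (a : ℕ → Fin 2) :
    MeasurableSet (cylinderSet k n a) := by
  rw [← word_preimage_singleton]
  exact measurable_word k n (measurableSet_singleton _)

lemma ext_of_cylinderSet {μ₁ μ₂ : Measure (ℤ → Fin 2)} [IsFiniteMeasure μ₁] [IsFiniteMeasure μ₂]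
    (h : ∀ k n a, μ₁ (cylinderSet k n a) = μ₂ (cylinderSet k n a)) : μ₁ = μ₂ := by
  refine IsProjectiveLimit.unique (P := fun I : Finset ℤ => μ₂.map I.restrict) (fun I => ?_)
    fun I => rfl
  obtain ⟨N, hN⟩ : ∃ N : ℕ, ∀ i ∈ I, i.natAbs ≤ N :=
    ⟨I.sup Int.natAbs, fun i hi => Finset.le_sup hi⟩
  have hw : μ₁.map (word (-N) (2 * N)) = μ₂.map (word (-N) (2 * N)) := by
    refine Measure.ext_of_singleton fun w => ?_
    obtain ⟨a, rfl, -⟩ := exists_eq_word w 0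
    rw [Measure.map_apply (by fun_prop) (measurableSet_singleton _),
      Measure.map_apply (by fun_prop) (measurableSet_singleton _), word_preimage_singleton, h]
  let r : (Fin (2 * N + 1) → Fin 2) → I → Fin 2 := fun w i =>
    w ⟨((i : ℤ) + N).toNat, by have := hN i i.2; omega⟩
  have hr : (I.restrict : (ℤ → Fin 2) → _) = r ∘ word (-N) (2 * N) := by
    ext1 η
    ext1 i
    have := hN i i.2
    simp only [Finset.restrict, Function.comp_apply, r, word]
    congr 1
    omega
  have hrm : Measurable r := measurable_of_countable _
  change μ₁.map I.restrict = μ₂.map I.restrict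
  rw [hr, ← Measure.map_map hrm (by fun_prop), hw, Measure.map_map hrm (by fun_prop)]

/-- `μ` gives to cylinders the probabilities of the Markov chain with transition matrix `P` that
starts with the law `π`. -/
def CylinderFormula (P : Matrix (Fin 2) (Fin 2) ℝ) (π : Fin 2 → ℝ) (μ : Measure (ℤ → Fin 2)) :
    Prop :=
  ∀ (k : ℤ) (n : ℕ) (a : ℕ → Fin 2), μ (cylinderSet k n a) =
    ENNReal.ofReal (π (a 0) * ∏ j ∈ Finset.range n, P (a j) (a (j + 1)))

/-- The Markov property at the site `m` for events `B` that depend on the sites from `l` to `m`. -/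
lemma markov_property {P : Matrix (Fin 2) (Fin 2) ℝ} {π : Fin 2 → ℝ} {μ : Measure (ℤ → Fin 2)}
    (hP : ∀ i j, 0 ≤ P i j) [IsProbabilityMeasure μ]
    (hμ : CylinderFormula P π μ) {l m : ℤ} (hlm : l ≤ m)
    (e f : Fin 2) {B : Set (ℤ → Fin 2)} (hBe : B ⊆ {η | η m = e})
    (hB : ∀ η η', (∀ j, l ≤ j → j ≤ m → η j = η' j) → η ∈ B → η' ∈ B) :
    μ (B ∩ {η | η (m + 1) = f}) = μ B * ENNReal.ofReal (P e f) := by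
  obtain ⟨n, rfl⟩ := Int.le.dest hlm
  -- The event `B` is a set of words; it is enough to compare the two sides on single words.
  have hBw : B = word l n ⁻¹' (word l n '' B) ∩ {η | η (l + n) = e} := by
    ext η
    constructor
    · exact fun h => ⟨⟨η, h, rfl⟩, hBe h⟩
    · rintro ⟨⟨η', h', hw⟩, -⟩
      refine hB η' η (fun j h1 h2 => ?_) h'
      have := congr_fun hw ⟨(j - l).toNat, by omega⟩
      simp only [word] at this
      rwa [show l + ((j - l).toNat : ℤ) = j by omega] at this
  have hE : MeasurableSet {η : ℤ → Fin 2 | η (l + n) = e} :=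
    measurableSet_eq_fun (by fun_prop) measurable_const
  have hF : MeasurableSet {η : ℤ → Fin 2 | η (l + n + 1) = f} :=
    measurableSet_eq_fun (by fun_prop) measurable_const
  have key : (μ.restrict ({η | η (l + n) = e} ∩ {η | η (l + n + 1) = f})).map (word l n) =
      ENNReal.ofReal (P e f) • (μ.restrict {η | η (l + n) = e}).map (word l n) := by
    refine Measure.ext_of_singleton fun w => ?_
    obtain ⟨a, rfl, ha⟩ := exists_eq_word w f
    have hc := measurableSet_cylinderSet l n a
    rw [Measure.smul_apply, Measure.map_apply (by fun_prop) (measurableSet_singleton _),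
      Measure.map_apply (by fun_prop) (measurableSet_singleton _), word_preimage_singleton,
      Measure.restrict_apply hc, Measure.restrict_apply hc]
    by_cases hae : a n = e
    · have h1 : cylinderSet l n a ∩ {η | η (l + n) = e} = cylinderSet l n a :=
        Set.inter_eq_left.2 fun η h => (h n le_rfl).trans hae
      have h2 : cylinderSet l n a ∩ {η | η (l + n + 1) = f} = cylinderSet l (n + 1) a := by
        ext η
        constructor
        · rintro ⟨h, h'⟩ j hj
          rcases Nat.le_succ_iff.1 hj with hj | rfl
          · exact h j hj
          · rw [ha, ← h', Nat.cast_succ, add_assoc]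
        · intro h
          refine ⟨fun j hj => h j (by omega), ?_⟩
          have := h (n + 1) le_rfl
          rwa [ha, Nat.cast_add, Nat.cast_one, ← add_assoc] at this
      rw [← Set.inter_assoc, h1, h2, hμ, hμ, smul_eq_mul, ← ENNReal.ofReal_mul (hP _ _),
        Finset.prod_range_succ, hae, ha]
      congr 1
      ring
    · have h1 : cylinderSet l n a ∩ {η | η (l + n) = e} = ∅ := by
        ext η
        simp only [Set.mem_inter_iff, Set.mem_empty_iff_false, iff_false, not_and]
        intro h h'
        exact hae ((h n le_rfl).symm.trans h')
      rw [← Set.inter_assoc, h1]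
      simp
  have hT : MeasurableSet (word l n '' B) := Set.toFinite _ |>.measurableSet
  have h3 := congr_arg (fun ν => ν (word l n '' B)) key
  simp only [Measure.smul_apply] at h3
  rw [Measure.map_apply (by fun_prop) hT, Measure.map_apply (by fun_prop) hT,
    Measure.restrict_apply (measurable_word l n hT), Measure.restrict_apply (measurable_word l n hT),
    ← Set.inter_assoc, ← hBw, smul_eq_mul, mul_comm] at h3
  exact h3

lemma map_update_coins {ι : Type} [DecidableEq ι] (p : unitInterval) (m : ι) :
    ((coins ι p).prod (coin p)).map (fun q => Function.update q.1 m q.2) = coins ι p := by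
  have hcoins : coins ι p = Measure.infinitePi fun _ : ι => coin p := rfl
  have := hcoins ▸ (inferInstance :
    IsProbabilityMeasure (Measure.infinitePi fun _ : ι => coin p))
  have hup : Measurable fun q : (ι → Bool) × Bool => Function.update q.1 m q.2 := measurable_update'
  rw [hcoins]
  refine Measure.eq_infinitePi _ fun s t ht => ?_
  rw [Measure.map_apply hup (.pi s.countable_toSet fun i _ => ht i)]
  have hset : (fun q : (ι → Bool) × Bool => Function.update q.1 m q.2) ⁻¹' Set.pi s t =
      Set.pi (s.erase m : Finset ι) t ×ˢ (if m ∈ s then t m else Set.univ) := by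
    ext q
    simp only [Set.mem_preimage, Set.mem_pi, Finset.mem_coe, Set.mem_prod, Finset.mem_erase]
    constructor
    · refine fun h => ⟨fun i hi => ?_, ?_⟩
      · simpa [Function.update_of_ne hi.1] using h i hi.2
      · split_ifs with hm
        · simpa using h m hm
        · trivial
    · rintro ⟨h1, h2⟩ i hi
      by_cases him : i = m
      · subst him
        simpa [hi] using h2
      · simpa [Function.update_of_ne him] using h1 i ⟨him, hi⟩
  rw [hset, Measure.prod_prod, Measure.infinitePi_pi _ fun i _ => ht i]
  by_cases hm : m ∈ s
  · rw [if_pos hm, Finset.prod_erase_mul s _ hm]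
  · rw [if_neg hm, measure_univ, mul_one, Finset.erase_eq_of_notMem hm]

instance {ι : Type} (p : unitInterval) : IsProbabilityMeasure (coins ι p) :=
  inferInstanceAs (IsProbabilityMeasure (Measure.infinitePi fun _ : ι => coin p))

/-- The coin `m` is independent of events that do not depend on it. -/
lemma coins_inter {ι : Type} [DecidableEq ι] (p : unitInterval) (m : ι) (s : Bool)
    {B : Set (ι → Bool)} (hBm : MeasurableSet B)
    (hB : ∀ c c', (∀ j ≠ m, c j = c' j) → c ∈ B → c' ∈ B) :
    coins ι p (B ∩ {c | c m = s}) = coins ι p B * coin p {s} := by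
  have hup : Measurable fun q : (ι → Bool) × Bool => Function.update q.1 m q.2 := measurable_update'
  have hs : MeasurableSet {c : ι → Bool | c m = s} :=
    measurableSet_eq_fun (by fun_prop) measurable_const
  rw [← Measure.prod_prod]
  conv_lhs => rw [← map_update_coins p m]
  rw [Measure.map_apply hup (hBm.inter hs)]
  congr 1
  ext ⟨c, s'⟩
  simp only [Set.mem_preimage, Set.mem_inter_iff, Set.mem_ofPred_eq, Function.update_self,
    Set.mem_prod, Set.mem_singleton_iff]
  refine and_congr_left fun _ => ⟨hB _ _ fun j hj => ?_, hB _ _ fun j hj => ?_⟩ <;>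
  simp [Function.update_of_ne hj]

/-- The event `A` depends only on the sites from `l` to `m` and on the coins before `m`. -/
def IsPast (l m : ℤ) (A : Set ((ℤ → Fin 2) × (ℤ → Bool))) : Prop :=
  ∀ η η' c c', (∀ j, l ≤ j → j ≤ m → η j = η' j) → (∀ j < m, c j = c' j) →
    (η, c) ∈ A → (η', c') ∈ A

lemma IsPast.inter {l m : ℤ} {A B : Set ((ℤ → Fin 2) × (ℤ → Bool))} (hA : IsPast l m A)
    (hB : IsPast l m B) : IsPast l m (A ∩ B) :=
  fun η η' c c' h1 h2 h => ⟨hA η η' c c' h1 h2 h.1, hB η η' c c' h1 h2 h.2⟩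

/-- The site `m + 1` and the coin `m` are independent of the past, given the site `m`. -/
lemma prod_markov_property {P : Matrix (Fin 2) (Fin 2) ℝ} {π : Fin 2 → ℝ}
    {μ : Measure (ℤ → Fin 2)}
    (hP : ∀ i j, 0 ≤ P i j) [IsProbabilityMeasure μ]
    (hμ : CylinderFormula P π μ) (p : unitInterval) {l m : ℤ} (hlm : l ≤ m)
    (e f : Fin 2) (s : Bool) {A : Set ((ℤ → Fin 2) × (ℤ → Bool))} (hAm : MeasurableSet A)
    (hAe : A ⊆ {q | q.1 m = e}) (hA : IsPast l m A) :
    (μ.prod (coins ℤ p)).real (A ∩ ({q | q.1 (m + 1) = f} ∩ {q | q.2 m = s})) =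
      (μ.prod (coins ℤ p)).real A * P e f * (coin p).real {s} := by
  have hF : MeasurableSet {q : (ℤ → Fin 2) × (ℤ → Bool) | q.1 (m + 1) = f} :=
    measurableSet_eq_fun (by fun_prop) measurable_const
  have hS : MeasurableSet {q : (ℤ → Fin 2) × (ℤ → Bool) | q.2 m = s} :=
    measurableSet_eq_fun (by fun_prop) measurable_const
  have h1 : (μ.prod (coins ℤ p)) (A ∩ {q | q.1 (m + 1) = f}) =
      (μ.prod (coins ℤ p)) A * ENNReal.ofReal (P e f) := by
    rw [Measure.prod_apply_symm (hAm.inter hF), Measure.prod_apply_symm hAm,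
      ← lintegral_mul_const' _ _ ENNReal.ofReal_ne_top]
    refine lintegral_congr fun c => ?_
    exact markov_property hP hμ hlm e f (B := (fun η => (η, c)) ⁻¹' A) (fun η h => hAe h)
      fun η η' h => hA η η' c c h fun _ _ => rfl
  have h2 : (μ.prod (coins ℤ p)) (A ∩ {q | q.1 (m + 1) = f} ∩ {q | q.2 m = s}) =
      (μ.prod (coins ℤ p)) (A ∩ {q | q.1 (m + 1) = f}) * coin p {s} := by
    rw [Measure.prod_apply ((hAm.inter hF).inter hS), Measure.prod_apply (hAm.inter hF),
      ← lintegral_mul_const' _ _ (measure_ne_top _ _)]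
    refine lintegral_congr fun η => ?_
    exact coins_inter p m s (B := Prod.mk η ⁻¹' (A ∩ {q | q.1 (m + 1) = f}))
      (measurable_prodMk_left (hAm.inter hF))
      fun c c' h h' => ⟨hA η η c c' (fun _ _ _ => rfl) (fun j hj => h j hj.ne) h'.1, h'.2⟩
  rw [← Set.inter_assoc, Measure.real, h2, h1, ENNReal.toReal_mul, ENNReal.toReal_mul,
    ENNReal.toReal_ofReal (hP e f)]
  rfl

/-! ### The hidden Markov chain behind the configuration after one step -/

/-- The state of the bond between the sites `k` and `k + 1` in one step: `2` if the site `k + 1` is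
occupied, `1` if it is empty and a particle jumps to it from `k`, and `0` otherwise. -/
def bondState (c : ℤ → Bool) (η : ℤ → Fin 2) (k : ℤ) : Fin 3 :=
  if η (k + 1) = 1 then 2 else if η k = 1 ∧ c k = true then 1 else 0

/-- The occupation of the right end of a bond in the state `s`. -/
def siteOf (s : Fin 3) : Fin 2 := if s = 2 then 1 else 0

/-- The state of the next bond, whose right end has the occupation `f` and whose left end has the
coin `b`. -/
def nextState (s : Fin 3) (f : Fin 2) (b : Bool) : Fin 3 :=
  if f = 1 then 2 else if s = 2 ∧ b = true then 1 else 0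

/-- The occupation after one step of the site between the bond in the state `s` and the next bond,
see `nextState`. -/
def output (s : Fin 3) (f : Fin 2) (b : Bool) : Fin 2 :=
  if (s = 2 ∧ ¬ (f = 0 ∧ b = true)) ∨ s = 1 then 1 else 0

lemma siteOf_bondState (c : ℤ → Bool) (η : ℤ → Fin 2) (k : ℤ) :
    siteOf (bondState c η k) = η (k + 1) := by
  unfold siteOf bondState
  generalize η (k + 1) = u
  fin_cases u
  · by_cases h : η k = 1 ∧ c k = true <;> simp [h]
  · simp

lemma bondState_add_one (c : ℤ → Bool) (η : ℤ → Fin 2) (k : ℤ) :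
    bondState c η (k + 1) = nextState (bondState c η k) (η (k + 1 + 1)) (c (k + 1)) := by
  have h : bondState c η k = 2 ↔ η (k + 1) = 1 := by
    rw [← siteOf_bondState c η k]
    unfold siteOf
    generalize bondState c η k = s
    fin_cases s <;> simp
  simp only [nextState, h]
  rfl

lemma siteStep_add_one (c : ℤ → Bool) (η : ℤ → Fin 2) (k : ℤ) :
    siteStep c η (k + 1) = output (bondState c η k) (η (k + 1 + 1)) (c (k + 1)) := by
  unfold siteStep output bondState Jumps
  rw [show k + 1 - 1 = k by ring]
  generalize η (k + 1) = u
  generalize η (k + 1 + 1) = v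
  generalize η k = w
  generalize c k = b
  generalize c (k + 1) = b'
  fin_cases u <;> fin_cases v <;> fin_cases w <;> cases b <;> cases b' <;> simp

lemma measurable_bondState (k : ℤ) :
    Measurable fun q : (ℤ → Fin 2) × (ℤ → Bool) => bondState q.2 q.1 k := by
  have h : Measurable fun x : Fin 2 × Fin 2 × Bool =>
      (if x.1 = 1 then 2 else if x.2.1 = 1 ∧ x.2.2 = true then 1 else 0 : Fin 3) :=
    measurable_of_countable _
  exact h.comp (f := fun q : (ℤ → Fin 2) × (ℤ → Bool) => (q.1 (k + 1), q.1 k, q.2 k))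
    (by fun_prop)

lemma measurable_siteStep_apply (k : ℤ) :
    Measurable fun q : (ℤ → Fin 2) × (ℤ → Bool) => siteStep q.2 q.1 k := by
  have h : Measurable fun x : Fin 3 × Fin 2 × Bool => output x.1 x.2.1 x.2.2 :=
    measurable_of_countable _
  obtain ⟨k, rfl⟩ : ∃ k', k = k' + 1 := ⟨k - 1, by ring⟩
  simp only [siteStep_add_one]
  exact h.comp (f := fun q : (ℤ → Fin 2) × (ℤ → Bool) =>
    (bondState q.2 q.1 k, q.1 (k + 1 + 1), q.2 (k + 1)))
    ((measurable_bondState k).prodMk (by fun_prop))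

lemma measurable_siteStep :
    Measurable fun q : (ℤ → Fin 2) × (ℤ → Bool) => siteStep q.2 q.1 :=
  measurable_pi_lambda _ measurable_siteStep_apply

lemma isPast_bondState {l k : ℤ} (hl : l ≤ k) (s : Fin 3) :
    IsPast l (k + 1) {q | bondState q.2 q.1 k = s} := by
  intro η η' c c' h1 h2 h
  simp only [Set.mem_ofPred_eq, bondState] at h ⊢
  simp only [h1 (k + 1) (by omega) le_rfl, h1 k hl (by omega), h2 k (by omega)] at h
  exact h

lemma isPast_siteStep {l k m : ℤ} (hl : l < k) (hm : k < m) (a : Fin 2) :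
    IsPast l m {q | siteStep q.2 q.1 k = a} := by
  intro η η' c c' h1 h2 h
  obtain ⟨k, rfl⟩ : ∃ k', k = k' + 1 := ⟨k - 1, by ring⟩
  simp only [Set.mem_ofPred_eq, siteStep_add_one, bondState] at h ⊢
  simp only [h1 (k + 1) (by omega) (by omega), h1 k (by omega) (by omega), h2 k (by omega),
    h1 (k + 1 + 1) (by omega) (by omega), h2 (k + 1) (by omega)] at h
  exact h

/-- The evolution of weights on the states of a bond when the site after the bond is read as `a`. -/
noncomputable def readWeight (p : ℝ) (P : Matrix (Fin 2) (Fin 2) ℝ) (a : Fin 2) (x : Fin 3 → ℝ) :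
    Fin 3 → ℝ :=
  fun s' => ∑ s : Fin 3, ∑ f : Fin 2, ∑ b : Bool,
    if nextState s f b = s' ∧ output s f b = a then
      x s * P (siteOf s) f * (if b = true then p else 1 - p) else 0

/-- The weights of the states of a bond in the stationary chain. -/
noncomputable def startWeight (p : ℝ) (P : Matrix (Fin 2) (Fin 2) ℝ) (π : Fin 2 → ℝ) :
    Fin 3 → ℝ :=
  ![π 0 * P 0 0 + π 1 * P 1 0 * (1 - p), π 1 * P 1 0 * p, π 0 * P 0 1 + π 1 * P 1 1]

/-- The weights of the states of a bond after `n` sites have been read as `a 0, …, a (n - 1)`. -/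
noncomputable def forwardWeight (p : ℝ) (P : Matrix (Fin 2) (Fin 2) ℝ) (π : Fin 2 → ℝ)
    (a : ℕ → Fin 2) : ℕ → Fin 3 → ℝ
  | 0 => startWeight p P π
  | n + 1 => readWeight p P (a n) (forwardWeight p P π a n)

lemma measureReal_eq_sum_inter {Ω F : Type*} [MeasurableSpace Ω] [Fintype F] [MeasurableSpace F]
    [MeasurableSingletonClass F] (μ : Measure Ω) [IsFiniteMeasure μ] {Y : Ω → F}
    (hY : Measurable Y) (S : Set Ω) :
    μ.real S = ∑ y, μ.real (S ∩ Y ⁻¹' {y}) := by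
  have h := sum_measureReal_preimage_singleton (μ := μ.restrict S) (f := Y) Finset.univ
    fun y _ => hY (measurableSet_singleton y)
  simp only [Finset.coe_univ, Set.preimage_univ] at h
  rw [measureReal_restrict_apply MeasurableSet.univ, Set.univ_inter] at h
  rw [← h]
  refine Finset.sum_congr rfl fun y _ => ?_
  rw [measureReal_restrict_apply (hY (measurableSet_singleton y)), Set.inter_comm]

lemma coin_real (p : unitInterval) (b : Bool) :
    (coin p).real {b} = if b = true then (p : ℝ) else 1 - p := by
  cases b <;> simp

lemma measureReal_site {P : Matrix (Fin 2) (Fin 2) ℝ} {π : Fin 2 → ℝ} {μ : Measure (ℤ → Fin 2)}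
    (hπ : ∀ i, 0 ≤ π i) (hμ : CylinderFormula P π μ) (p : unitInterval) (k : ℤ) (e : Fin 2) :
    (μ.prod (coins ℤ p)).real {q | q.1 k = e} = π e := by
  have h1 : {q : (ℤ → Fin 2) × (ℤ → Bool) | q.1 k = e} =
      cylinderSet k 0 (fun _ => e) ×ˢ Set.univ := by
    ext q
    simp [cylinderSet]
  rw [h1, measureReal_prod_prod, Measure.real, hμ]
  simp [hπ e]

section

variable {P : Matrix (Fin 2) (Fin 2) ℝ} {π : Fin 2 → ℝ} {μ : Measure (ℤ → Fin 2)}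
  (hP : ∀ i j, 0 ≤ P i j) (hπ : ∀ i, 0 ≤ π i) [IsProbabilityMeasure μ]
  (hμ : CylinderFormula P π μ) (p : unitInterval)

include hP hμ

/-- One step of the forward recursion: the weights of the states of a bond, on an event `A` of the
past, evolve by `readWeight` when one more site is read. -/
lemma measureReal_read {l k : ℤ} (hlk : l ≤ k) (a : Fin 2)
    {A : Set ((ℤ → Fin 2) × (ℤ → Bool))} (hAm : MeasurableSet A) (hA : IsPast l (k + 1) A)
    (s' : Fin 3) :
    (μ.prod (coins ℤ p)).real (A ∩ {q | siteStep q.2 q.1 (k + 1) = a} ∩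
        {q | bondState q.2 q.1 (k + 1) = s'}) =
      readWeight p P a
        (fun s => (μ.prod (coins ℤ p)).real (A ∩ {q | bondState q.2 q.1 k = s})) s' := by
  have hbs : ∀ k s, MeasurableSet {q : (ℤ → Fin 2) × (ℤ → Bool) | bondState q.2 q.1 k = s} :=
    fun k s => measurableSet_eq_fun (measurable_bondState k) measurable_const
  have hY : Measurable fun q : (ℤ → Fin 2) × (ℤ → Bool) =>
      (bondState q.2 q.1 k, q.1 (k + 1 + 1), q.2 (k + 1)) :=
    (measurable_bondState k).prodMk (by fun_prop)
  rw [measureReal_eq_sum_inter _ hY]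
  simp only [readWeight, Fintype.sum_prod_type]
  refine Finset.sum_congr rfl fun s _ => Finset.sum_congr rfl fun f _ =>
    Finset.sum_congr rfl fun b _ => ?_
  by_cases h : nextState s f b = s' ∧ output s f b = a
  · have hset : A ∩ {q | siteStep q.2 q.1 (k + 1) = a} ∩
        {q | bondState q.2 q.1 (k + 1) = s'} ∩
        (fun q : (ℤ → Fin 2) × (ℤ → Bool) =>
          (bondState q.2 q.1 k, q.1 (k + 1 + 1), q.2 (k + 1))) ⁻¹' {(s, f, b)} =
        A ∩ {q | bondState q.2 q.1 k = s} ∩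
          ({q | q.1 (k + 1 + 1) = f} ∩ {q | q.2 (k + 1) = b}) := by
      ext q
      simp only [Set.mem_inter_iff, Set.mem_ofPred_eq, Set.mem_preimage, Set.mem_singleton_iff,
        Prod.mk.injEq]
      constructor
      · rintro ⟨⟨⟨h1, -⟩, -⟩, h2, h3, h4⟩
        exact ⟨⟨h1, h2⟩, h3, h4⟩
      · rintro ⟨⟨h1, h2⟩, h3, h4⟩
        refine ⟨⟨⟨h1, ?_⟩, ?_⟩, h2, h3, h4⟩
        · rw [siteStep_add_one, h2, h3, h4, h.2]
        · rw [bondState_add_one, h2, h3, h4, h.1]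
    rw [hset, prod_markov_property hP hμ p (l := l) (by omega) (siteOf s) f b
      (hAm.inter (hbs k s)) ?_ (hA.inter (isPast_bondState hlk s)), coin_real, if_pos h]
    rintro q ⟨-, hq⟩
    exact (siteOf_bondState q.2 q.1 k).symm.trans (congr_arg siteOf hq)
  · have hset : A ∩ {q | siteStep q.2 q.1 (k + 1) = a} ∩
        {q | bondState q.2 q.1 (k + 1) = s'} ∩
        (fun q : (ℤ → Fin 2) × (ℤ → Bool) =>
          (bondState q.2 q.1 k, q.1 (k + 1 + 1), q.2 (k + 1))) ⁻¹' {(s, f, b)} = ∅ := by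
      ext q
      simp only [Set.mem_inter_iff, Set.mem_ofPred_eq, Set.mem_preimage, Set.mem_singleton_iff,
        Prod.mk.injEq, Set.mem_empty_iff_false, iff_false]
      rintro ⟨⟨⟨-, h1⟩, h2⟩, h3, h4, h5⟩
      rw [siteStep_add_one, h3, h4, h5] at h1
      rw [bondState_add_one, h3, h4, h5] at h2
      exact h ⟨h2, h1⟩
    rw [hset, measureReal_empty, if_neg h]

include hπ

lemma measureReal_bondState (k : ℤ) (s : Fin 3) :
    (μ.prod (coins ℤ p)).real {q | bondState q.2 q.1 k = s} = startWeight p P π s := by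
  have hY : Measurable fun q : (ℤ → Fin 2) × (ℤ → Bool) =>
      (q.1 k, q.1 (k + 1), q.2 k) := by fun_prop
  rw [measureReal_eq_sum_inter _ hY]
  have key : ∀ e f b, (μ.prod (coins ℤ p)).real ({q | bondState q.2 q.1 k = s} ∩
      (fun q : (ℤ → Fin 2) × (ℤ → Bool) => (q.1 k, q.1 (k + 1), q.2 k)) ⁻¹' {(e, f, b)}) =
      if (if f = 1 then 2 else if e = 1 ∧ b = true then 1 else 0) = s then
        π e * P e f * (if b = true then (p : ℝ) else 1 - p) else 0 := by
    intro e f b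
    by_cases h : (if f = 1 then 2 else if e = 1 ∧ b = true then 1 else 0 : Fin 3) = s
    · have hset : {q : (ℤ → Fin 2) × (ℤ → Bool) | bondState q.2 q.1 k = s} ∩
          (fun q : (ℤ → Fin 2) × (ℤ → Bool) => (q.1 k, q.1 (k + 1), q.2 k)) ⁻¹' {(e, f, b)} =
          {q | q.1 k = e} ∩ ({q | q.1 (k + 1) = f} ∩ {q | q.2 k = b}) := by
        ext q
        simp only [Set.mem_inter_iff, Set.mem_ofPred_eq, Set.mem_preimage,
          Set.mem_singleton_iff, Prod.mk.injEq, and_iff_right_iff_imp]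
        rintro ⟨h1, h2, h3⟩
        simp only [bondState, h1, h2, h3]
        exact h
      rw [hset, prod_markov_property hP hμ p (l := k) le_rfl e f b
        (measurableSet_eq_fun (by fun_prop) measurable_const) (fun q hq => hq) ?_,
        measureReal_site hπ hμ, coin_real, if_pos h]
      exact fun η η' c c' h1 _ h => (h1 k le_rfl le_rfl).symm.trans h
    · have hset : {q : (ℤ → Fin 2) × (ℤ → Bool) | bondState q.2 q.1 k = s} ∩
          (fun q : (ℤ → Fin 2) × (ℤ → Bool) => (q.1 k, q.1 (k + 1), q.2 k)) ⁻¹' {(e, f, b)} =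
          ∅ := by
        ext q
        simp only [Set.mem_inter_iff, Set.mem_ofPred_eq, Set.mem_preimage,
          Set.mem_singleton_iff, Prod.mk.injEq, Set.mem_empty_iff_false, iff_false]
        rintro ⟨h0, h1, h2, h3⟩
        simp only [bondState, h1, h2, h3] at h0
        exact h h0
      rw [hset, measureReal_empty, if_neg h]
  simp only [Fintype.sum_prod_type, key]
  fin_cases s <;> simp [Fin.sum_univ_two, startWeight] <;> ring

/-- The forward recursion for the configuration after one step. -/
theorem measureReal_forward (k : ℤ) (a : ℕ → Fin 2) (n : ℕ) (s : Fin 3) :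
    (μ.prod (coins ℤ p)).real ({q | ∀ j < n, siteStep q.2 q.1 (k + 1 + j) = a j} ∩
      {q | bondState q.2 q.1 (k + n) = s}) = forwardWeight p P π a n s := by
  induction n generalizing s with
  | zero => simpa [forwardWeight] using measureReal_bondState hP hπ hμ p k s
  | succ n ih =>
    have hA : {q : (ℤ → Fin 2) × (ℤ → Bool) |
        ∀ j < n, siteStep q.2 q.1 (k + 1 + j) = a j} =
        ⋂ j ∈ Set.Iio n, {q | siteStep q.2 q.1 (k + 1 + j) = a j} := by
      ext q
      simp
    have hAm : MeasurableSet {q : (ℤ → Fin 2) × (ℤ → Bool) |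
        ∀ j < n, siteStep q.2 q.1 (k + 1 + j) = a j} := by
      rw [hA]
      exact MeasurableSet.biInter (Set.to_countable _) fun j _ =>
        measurableSet_eq_fun (measurable_siteStep_apply _) measurable_const
    have hAp : IsPast k (k + n + 1) {q : (ℤ → Fin 2) × (ℤ → Bool) |
        ∀ j < n, siteStep q.2 q.1 (k + 1 + j) = a j} := fun η η' c c' h1 h2 h j hj =>
      isPast_siteStep (by omega) (by omega) (a j) η η' c c' h1 h2 (h j hj)
    have h := measureReal_read hP hμ p (l := k) (k := k + n) (by omega) (a n) hAm hAp s
    simp only [ih] at h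
    rw [forwardWeight, ← h]
    congr 1
    ext q
    simp only [Set.mem_inter_iff, Set.mem_ofPred_eq, Nat.lt_succ_iff_lt_or_eq, or_imp, forall_and,
      forall_eq]
    push_cast
    rw [← add_assoc, add_right_comm k 1 (n : ℤ)]

lemma measureReal_output (k : ℤ) (a : ℕ → Fin 2) (n : ℕ) :
    (μ.prod (coins ℤ p)).real {q | ∀ j < n, siteStep q.2 q.1 (k + j) = a j} =
      ∑ s, forwardWeight p P π a n s := by
  rw [measureReal_eq_sum_inter _ (measurable_bondState (k - 1 + n))]
  refine Finset.sum_congr rfl fun s _ => ?_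
  have h := measureReal_forward hP hπ hμ p (k - 1) a n s
  rw [show k - 1 + 1 = k by ring] at h
  exact h

end

/-! ### Invariance of a Markov measure -/

lemma readWeight_zero (p : ℝ) (P : Matrix (Fin 2) (Fin 2) ℝ) (x : Fin 3 → ℝ) :
    readWeight p P 0 x = ![x 0 * P 0 0, x 2 * P 1 0 * p, x 0 * P 0 1] := by
  ext s
  fin_cases s <;>
  simp [readWeight, Fin.sum_univ_three, Fin.sum_univ_two, nextState, output, siteOf] <;> ring

lemma readWeight_one (p : ℝ) (P : Matrix (Fin 2) (Fin 2) ℝ) (x : Fin 3 → ℝ) :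
    readWeight p P 1 x =
      ![x 1 * P 0 0 + x 2 * P 1 0 * (1 - p), 0, x 1 * P 0 1 + x 2 * P 1 1] := by
  ext s
  fin_cases s <;>
  simp [readWeight, Fin.sum_univ_three, Fin.sum_univ_two, nextState, output, siteOf] <;> ring

lemma readWeight_smul (p : ℝ) (P : Matrix (Fin 2) (Fin 2) ℝ) (a : Fin 2) (r : ℝ) (x : Fin 3 → ℝ) :
    readWeight p P a (r • x) = r • readWeight p P a x := by
  ext s
  simp only [readWeight, Pi.smul_apply, smul_eq_mul, Finset.mul_sum, mul_ite, mul_zero, mul_assoc]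

/-- The law of the state of a bond given the configuration after one step to the left of the bond:
it depends only on the last site that is read. -/
noncomputable def bondLaw (p b : ℝ) : Fin 2 → Fin 3 → ℝ :=
  ![![(1 - p * b) * (1 - b), p * b, (1 - p * b) * b], ![1 - b, 0, b]]

lemma sum_bondLaw (p b : ℝ) (e : Fin 2) : ∑ s, bondLaw p b e s = 1 := by
  fin_cases e <;> simp [bondLaw, Fin.sum_univ_three]
  ring

section

variable {P : Matrix (Fin 2) (Fin 2) ℝ} {π : Fin 2 → ℝ} {p : ℝ}
  (h0 : P 0 0 = 1 - P 0 1) (h1 : P 1 1 = 1 - P 1 0) (hπ : π 0 * P 0 1 = π 1 * P 1 0)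
  (hab : P 1 0 + P 0 1 = 1 + p * P 1 0 * P 0 1)

include h0 h1 hab

/-- The states of the bonds form a hidden Markov chain that is lumpable along the sites read:
with the weights `bondLaw`, the next site is read as `f` with the transition probability of `P`, and
the weights are `bondLaw` again. -/
lemma readWeight_bondLaw (e f : Fin 2) :
    readWeight p P f (bondLaw p (P 0 1) e) = P e f • bondLaw p (P 0 1) f := by
  ext s
  fin_cases e <;> fin_cases f <;> fin_cases s <;>
  simp [readWeight_zero, readWeight_one, bondLaw, h0, h1]
  · ring
  · linear_combination p * P 0 1 * hab
  · ring
  · linear_combination P 0 1 * (1 - p) * hab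
  · linear_combination -P 0 1 * hab
  · linear_combination -(1 - P 0 1) * hab
  · ring
  · linear_combination -P 0 1 * hab
  · linear_combination hab
  · ring

include hπ

lemma readWeight_startWeight (e : Fin 2) :
    readWeight p P e (startWeight p P π) = π e • bondLaw p (P 0 1) e := by
  ext s
  fin_cases e <;> fin_cases s <;>
  simp [readWeight_zero, readWeight_one, bondLaw, startWeight, h0, h1]
  · linear_combination -(1 - P 0 1) * (1 - p) * hπ
  · linear_combination p * (P 1 0 - 1) * hπ
  · linear_combination -P 0 1 * (1 - p) * hπ
  · linear_combination P 1 0 * (1 - p) * hπ + π 1 * hab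
  · linear_combination (1 - P 1 0) * hπ - π 1 * hab

lemma forwardWeight_eq (a : ℕ → Fin 2) (n : ℕ) :
    forwardWeight p P π a (n + 1) =
      (π (a 0) * ∏ j ∈ Finset.range n, P (a j) (a (j + 1))) • bondLaw p (P 0 1) (a n) := by
  induction n with
  | zero => simp [forwardWeight, readWeight_startWeight h0 h1 hπ hab]
  | succ n ih =>
    rw [forwardWeight, ih, readWeight_smul, readWeight_bondLaw h0 h1 hab, smul_smul,
      Finset.prod_range_succ, mul_assoc]

end

theorem invariant_of_cylinderFormula {P : Matrix (Fin 2) (Fin 2) ℝ} {π : Fin 2 → ℝ}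
    {μ : Measure (ℤ → Fin 2)} [IsProbabilityMeasure μ] {p : unitInterval}
    (hP : ∀ i j, 0 ≤ P i j) (hπ0 : ∀ i, 0 ≤ π i) (hμ : CylinderFormula P π μ)
    (h0 : P 0 0 = 1 - P 0 1) (h1 : P 1 1 = 1 - P 1 0) (hπ : π 0 * P 0 1 = π 1 * P 1 0)
    (hab : P 1 0 + P 0 1 = 1 + p * P 1 0 * P 0 1) : Invariant p μ := by
  have := Measure.isProbabilityMeasure_map (μ := μ.prod (coins ℤ p))
    measurable_siteStep.aemeasurable
  refine ext_of_cylinderSet fun k n a => ?_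
  rw [Measure.map_apply measurable_siteStep (measurableSet_cylinderSet k n a), hμ]
  have h := measureReal_output hP hπ0 hμ p k a (n + 1)
  simp only [forwardWeight_eq h0 h1 hπ hab, Pi.smul_apply, smul_eq_mul, ← Finset.mul_sum,
    sum_bondLaw, mul_one] at h
  rw [← h, ofReal_measureReal]
  congr 1
  ext q
  simp [cylinderSet]

/-- Invariance of the probability of the word `10` determines the transition matrix. -/
theorem transition_of_invariant {P : Matrix (Fin 2) (Fin 2) ℝ} {π : Fin 2 → ℝ}
    {μ : Measure (ℤ → Fin 2)} [IsProbabilityMeasure μ] {p : unitInterval} (hp0 : 0 < (p : ℝ))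
    (hP : ∀ i j, 0 < P i j) (hπ0 : ∀ i, 0 ≤ π i) (hμ : CylinderFormula P π μ)
    (h0 : P 0 0 = 1 - P 0 1) (h1 : P 1 1 = 1 - P 1 0) (hπ : π 0 * P 0 1 = π 1 * P 1 0)
    (hπ1 : 0 < π 1) (hinv : Invariant p μ) :
    P 1 0 + P 0 1 = 1 + p * P 1 0 * P 0 1 := by
  have hP' : ∀ i j, 0 ≤ P i j := fun i j => (hP i j).le
  let a : ℕ → Fin 2 := fun j => if j = 0 then 1 else 0
  have h := measureReal_output hP' hπ0 hμ p 0 a 2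
  have hset : {q : (ℤ → Fin 2) × (ℤ → Bool) | ∀ j < 2, siteStep q.2 q.1 (0 + (j : ℕ)) = a j} =
      (fun q : (ℤ → Fin 2) × (ℤ → Bool) => siteStep q.2 q.1) ⁻¹' cylinderSet 0 1 a := by
    ext q
    simp [cylinderSet]
  rw [hset, ← map_measureReal_apply measurable_siteStep (measurableSet_cylinderSet 0 1 a), hinv,
    Measure.real, hμ, ENNReal.toReal_ofReal (mul_nonneg (hπ0 _) (Finset.prod_nonneg
      fun _ _ => hP' _ _))] at h
  have ha0 : a 0 = 1 := rfl
  have ha1 : a 1 = 0 := rfl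
  simp only [forwardWeight, ha0, ha1, readWeight_zero, readWeight_one, Fin.sum_univ_three,
    startWeight, Finset.prod_range_one, zero_add] at h
  simp [h0, h1] at h
  have h2 : π 1 * P 1 0 * p * (P 1 0 + P 0 1 - (1 + p * P 1 0 * P 0 1)) = 0 := by
    linear_combination h + (P 1 0 * (1 - p) + (1 - P 1 0) * P 1 0 * p) * hπ
  have h3 : π 1 * P 1 0 * p ≠ 0 := (mul_pos (mul_pos hπ1 (hP 1 0)) hp0).ne'
  linarith [(mul_eq_zero.1 h2).resolve_left h3]

/-- A transition matrix with the density `ρ` that satisfies the invariance equation has the jump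
rate `V(ρ)`. -/
lemma mul_eq_velocity {p ρ a b : ℝ} (hp0 : 0 < p) (hp1 : p < 1) (hρ0 : 0 < ρ) (hρ1 : ρ < 1)
    (ha0 : 0 < a) (ha1 : a < 1) (hb1 : b < 1) (hρ : (1 - ρ) * b = ρ * a)
    (hab : a + b = 1 + p * a * b) : p * a = velocity p ρ := by
  obtain ⟨hv0, hvp, hv2, hv⟩ := velocity_spec hp0 hp1 hρ0 hρ1.le
  set v := velocity p ρ
  have h1 : ρ * (p * a) ^ 2 - p * a + p * (1 - ρ) = 0 := by
    linear_combination -p * (1 - ρ) * hab - p * (p * a - 1) * hρ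
  have h2 : (p * a - v) * (ρ * (p * a + v) - 1) = 0 := by linear_combination h1 - hv
  rcases mul_eq_zero.1 h2 with h | h
  · linarith
  -- The other root of the quadratic equation is too large.
  · exfalso
    have h3 : 0 ≤ a * (2 * ρ * (p * a) - 1) := mul_nonneg ha0.le (by linarith)
    have h4 : ρ * p * a ^ 2 - a + (1 - ρ) = 0 := by
      have : p * (ρ * p * a ^ 2 - a + (1 - ρ)) = 0 := by linear_combination h1
      exact (mul_eq_zero.1 this).resolve_left hp0.ne'
    have h5 : 2 * (1 - ρ) ≤ a := by linarith
    have h6 : 0 < (2 * ρ - 1) * (1 - ρ) := mul_pos (by linarith) (by linarith)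
    have h7 : (1 - ρ) * b < (1 - ρ) * 1 := mul_lt_mul_of_pos_left hb1 (by linarith)
    nlinarith

/-! ### Construction of the two-sided Markov chain -/

/-- The orbit of `e` under the maps `ξ 0, ξ 1, …`. -/
def orbit (ξ : ℕ → Fin 2 → Fin 2) (e : Fin 2) : ℕ → Fin 2
  | 0 => e
  | n + 1 => ξ n (orbit ξ e n)

/-- The configuration which has the orbits of its value at the origin under `ξ` and `ξ'` on the
two sides of the origin. -/
def twoSidedOrbit (e : Fin 2) (ξ ξ' : ℕ → Fin 2 → Fin 2) : ℤ → Fin 2 :=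
  fun k => if 0 ≤ k then orbit ξ e k.toNat else orbit ξ' e (-k).toNat

lemma measurable_orbit (n : ℕ) :
    Measurable fun q : Fin 2 × (ℕ → Fin 2 → Fin 2) => orbit q.2 q.1 n := by
  induction n with
  | zero => exact measurable_fst
  | succ n ih =>
    have h : Measurable fun x : (Fin 2 → Fin 2) × Fin 2 => x.1 x.2 := measurable_of_countable _
    exact h.comp (((measurable_pi_apply n).comp measurable_snd).prodMk ih)

lemma measurable_twoSidedOrbit :
    Measurable fun q : Fin 2 × (ℕ → Fin 2 → Fin 2) × (ℕ → Fin 2 → Fin 2) =>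
      twoSidedOrbit q.1 q.2.1 q.2.2 := by
  refine measurable_pi_lambda _ fun k => ?_
  unfold twoSidedOrbit
  split_ifs
  · exact (measurable_orbit k.toNat).comp
      (f := fun q : Fin 2 × (ℕ → Fin 2 → Fin 2) × (ℕ → Fin 2 → Fin 2) => (q.1, q.2.1))
      (by fun_prop)
  · exact (measurable_orbit (-k).toNat).comp
      (f := fun q : Fin 2 × (ℕ → Fin 2 → Fin 2) × (ℕ → Fin 2 → Fin 2) => (q.1, q.2.2))
      (by fun_prop)

lemma orbit_eq_iff (ξ : ℕ → Fin 2 → Fin 2) (u : ℕ → Fin 2) (n : ℕ) :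
    (∀ j ≤ n, orbit ξ (u 0) j = u j) ↔ ∀ j < n, ξ j (u j) = u (j + 1) := by
  constructor
  · intro h j hj
    rw [← h (j + 1) (by omega), orbit, h j (by omega)]
  · intro h j
    induction j with
    | zero => intro _; rfl
    | succ j ih =>
      intro hj
      rw [orbit, ih (by omega), h j (by omega)]

/-- The law on `Fin 2` that gives the weight `q` to `1`. -/
noncomputable abbrev letterLaw (q : unitInterval) : Measure (Fin 2) := bernoulliMeasure 1 0 q

/-- The law of a random map that sends `e` to `1` with probability `r e`. -/
noncomputable abbrev mapLaw (r : Fin 2 → unitInterval) : Measure (Fin 2 → Fin 2) :=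
  Measure.pi fun e => letterLaw (r e)

/-- The law of the two-sided stationary chain, glued at the origin from two one-sided chains. -/
noncomputable def chainMeasure (q : unitInterval) (r : Fin 2 → unitInterval) :
    Measure (ℤ → Fin 2) :=
  ((letterLaw q).prod ((Measure.infinitePi fun _ : ℕ => mapLaw r).prod
    (Measure.infinitePi fun _ : ℕ => mapLaw r))).map fun x => twoSidedOrbit x.1 x.2.1 x.2.2

instance (q : unitInterval) (r : Fin 2 → unitInterval) :
    IsProbabilityMeasure (chainMeasure q r) :=
  Measure.isProbabilityMeasure_map measurable_twoSidedOrbit.aemeasurable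

/-- The weights of `letterLaw`. -/
noncomputable def letterWeight (q : ℝ) (e : Fin 2) : ℝ := if e = 1 then q else 1 - q

lemma letterLaw_singleton (q : unitInterval) (e : Fin 2) :
    letterLaw q {e} = ENNReal.ofReal (letterWeight q e) := by
  rw [← ofReal_measureReal]
  congr 1
  fin_cases e <;> simp [letterWeight]

lemma letterWeight_nonneg (q : unitInterval) (e : Fin 2) : 0 ≤ letterWeight q e := by
  unfold letterWeight
  split_ifs
  · exact q.2.1
  · linarith [q.2.2]

lemma infinitePi_mapLaw (r : Fin 2 → unitInterval) (u : ℕ → Fin 2) (n : ℕ) :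
    (Measure.infinitePi fun _ : ℕ => mapLaw r) {ξ | ∀ j < n, ξ j (u j) = u (j + 1)} =
      ENNReal.ofReal (∏ j ∈ Finset.range n, letterWeight (r (u j)) (u (j + 1))) := by
  have hset : {ξ : ℕ → Fin 2 → Fin 2 | ∀ j < n, ξ j (u j) = u (j + 1)} =
      Set.pi (Finset.range n : Set ℕ) fun j => {f : Fin 2 → Fin 2 | f (u j) = u (j + 1)} := by
    ext ξ
    simp
  rw [hset, Measure.infinitePi_pi _ fun j _ => (Set.toFinite _).measurableSet,
    ENNReal.ofReal_prod_of_nonneg fun j _ => letterWeight_nonneg _ _]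
  refine Finset.prod_congr rfl fun j _ => ?_
  rw [← letterLaw_singleton, ← (measurePreserving_eval (fun e => letterLaw (r e))
    (u j)).measure_preimage (measurableSet_singleton _).nullMeasurableSet]
  rfl

/-- The probabilities of the words on intervals that contain the origin. -/
lemma chainMeasure_cylinderSet_origin (q : unitInterval) (r : Fin 2 → unitInterval) {π : Fin 2 → ℝ}
    {P : Matrix (Fin 2) (Fin 2) ℝ} (hπ : ∀ e, letterWeight q e = π e)
    (hP : ∀ e f, letterWeight (r e) f = P e f) (hrev : ∀ e f, π e * P e f = π f * P f e)
    (m n : ℕ) (a : ℕ → Fin 2) :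
    chainMeasure q r (cylinderSet (-m) (m + n) a) =
      ENNReal.ofReal (π (a 0) * ∏ j ∈ Finset.range (m + n), P (a j) (a (j + 1))) := by
  have hset : (fun x : Fin 2 × (ℕ → Fin 2 → Fin 2) × (ℕ → Fin 2 → Fin 2) =>
      twoSidedOrbit x.1 x.2.1 x.2.2) ⁻¹' cylinderSet (-m) (m + n) a =
      {a m} ×ˢ ({ξ | ∀ j < n, ξ j (a (m + j)) = a (m + (j + 1))} ×ˢ
        {ξ | ∀ j < m, ξ j (a (m - j)) = a (m - (j + 1))}) := by
    ext ⟨e, ξ, ξ'⟩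
    simp only [Set.mem_preimage, Set.mem_prod, Set.mem_singleton_iff, Set.mem_ofPred_eq,
      cylinderSet]
    have h1 := orbit_eq_iff ξ (fun j => a (m + j)) n
    have h2 := orbit_eq_iff ξ' (fun j => a (m - j)) m
    simp only [add_zero, Nat.sub_zero] at h1 h2
    rw [← h1, ← h2]
    constructor
    · intro h
      have he : e = a m := by simpa [twoSidedOrbit, orbit] using h m (by omega)
      subst he
      refine ⟨rfl, fun j hj => ?_, fun j hj => ?_⟩
      · have h3 := h (m + j) (by omega)
        rw [twoSidedOrbit, if_pos (by omega)] at h3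
        rw [← h3]
        congr 1
        omega
      · rcases Nat.eq_zero_or_pos j with rfl | hj0
        · rfl
        have h3 := h (m - j) (by omega)
        rw [twoSidedOrbit, if_neg (by omega)] at h3
        rw [← h3]
        congr 1
        omega
    · rintro ⟨rfl, h3, h4⟩ j hj
      rcases le_or_gt m j with hmj | hmj
      · have h5 := h3 (j - m) (by omega)
        rw [show m + (j - m) = j by omega] at h5
        rw [twoSidedOrbit, if_pos (by omega), ← h5]
        congr 1
        omega
      · have h5 := h4 (m - j) (by omega)
        rw [show m - (m - j) = j by omega] at h5
        rw [twoSidedOrbit, if_neg (by omega), ← h5]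
        congr 1
        omega
  have hπ0 : ∀ e, 0 ≤ π e := fun e => hπ e ▸ letterWeight_nonneg _ _
  have hP0 : ∀ e f, 0 ≤ P e f := fun e f => hP e f ▸ letterWeight_nonneg _ _
  -- By reversibility the left half may be read from left to right.
  have hback : ∀ i ≤ m, π (a m) * ∏ j ∈ Finset.range i, P (a (m - j)) (a (m - (j + 1))) =
      π (a (m - i)) * ∏ j ∈ Finset.range i, P (a (m - i + j)) (a (m - i + (j + 1))) := by
    intro i
    induction i with
    | zero => intro _; simp
    | succ i ih =>
      intro hi
      rw [Finset.prod_range_succ, ← mul_assoc, ih (by omega), Finset.prod_range_succ',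
        mul_right_comm, hrev]
      rw [show m - i = m - (i + 1) + 1 by omega]
      simp only [add_zero, zero_add]
      have : ∀ j, m - (i + 1) + 1 + j = m - (i + 1) + (j + 1) := fun j => by omega
      simp only [this]
      ring
  have hb := hback m le_rfl
  simp only [Nat.sub_self, zero_add] at hb
  rw [chainMeasure, Measure.map_apply measurable_twoSidedOrbit (measurableSet_cylinderSet _ _ _),
    hset, Measure.prod_prod, Measure.prod_prod, infinitePi_mapLaw r (fun j => a (m + j)),
    infinitePi_mapLaw r (fun j => a (m - j)), letterLaw_singleton]
  simp only [hπ, hP]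
  rw [← ENNReal.ofReal_mul (Finset.prod_nonneg fun _ _ => hP0 _ _), ← ENNReal.ofReal_mul (hπ0 _),
    Finset.prod_range_add, ← mul_assoc (π (a 0)), ← hb]
  congr 1
  simp only [add_assoc]
  ring

lemma cylinderFormula_chainMeasure (q : unitInterval) (r : Fin 2 → unitInterval) {π : Fin 2 → ℝ}
    {P : Matrix (Fin 2) (Fin 2) ℝ} (hπ : ∀ e, letterWeight q e = π e)
    (hP : ∀ e f, letterWeight (r e) f = P e f) (hrev : ∀ e f, π e * P e f = π f * P f e) :
    CylinderFormula P π (chainMeasure q r) := by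
  have hπ0 : ∀ e, 0 ≤ π e := fun e => hπ e ▸ letterWeight_nonneg _ _
  have hP0 : ∀ e f, 0 ≤ P e f := fun e f => hP e f ▸ letterWeight_nonneg _ _
  have hP1 : ∀ e, P e 0 + P e 1 = 1 := fun e => by
    rw [← hP, ← hP]; simp [letterWeight]
  have hnn : ∀ (n : ℕ) (a : ℕ → Fin 2),
      0 ≤ π (a 0) * ∏ j ∈ Finset.range n, P (a j) (a (j + 1)) := fun n a =>
    mul_nonneg (hπ0 _) (Finset.prod_nonneg fun _ _ => hP0 _ _)
  let formula : ℤ → ℕ → Prop := fun k n => ∀ a : ℕ → Fin 2, chainMeasure q r (cylinderSet k n a) =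
    ENNReal.ofReal (π (a 0) * ∏ j ∈ Finset.range n, P (a j) (a (j + 1)))
  have hsplit : ∀ (k : ℤ) (S : Set (ℤ → Fin 2)), chainMeasure q r S =
      chainMeasure q r (S ∩ {η | η k = 0}) + chainMeasure q r (S ∩ {η | η k = 1}) := by
    intro k S
    have hm : MeasurableSet {η : ℤ → Fin 2 | η k = 0} :=
      measurableSet_eq_fun (by fun_prop) measurable_const
    rw [← measure_inter_add_sdiff S hm]
    congr 2
    ext η
    simp only [Set.mem_sdiff, Set.mem_inter_iff, Set.mem_ofPred_eq]
    exact and_congr_right fun _ => by omega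
  -- The formula passes to shorter words by summation over the last or over the first letter.
  have hright : ∀ k n, formula k (n + 1) → formula k n := by
    intro k n h a
    have hset : ∀ e, cylinderSet k n a ∩ {η | η (k + n + 1) = e} =
        cylinderSet k (n + 1) (Function.update a (n + 1) e) := by
      intro e
      ext η
      simp only [cylinderSet, Set.mem_inter_iff, Set.mem_ofPred_eq, Nat.le_succ_iff, or_imp,
        forall_and, forall_eq, Function.update_self]
      push_cast
      rw [← add_assoc]
      refine and_congr_left fun _ => forall₂_congr fun j hj => ?_
      rw [Function.update_of_ne (by omega)]
    have hval : ∀ e, chainMeasure q r (cylinderSet k n a ∩ {η | η (k + n + 1) = e}) =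
        ENNReal.ofReal (π (a 0) * (∏ j ∈ Finset.range n, P (a j) (a (j + 1))) * P (a n) e) := by
      intro e
      rw [hset, h, Finset.prod_range_succ, Function.update_self, Function.update_of_ne (by omega),
        Function.update_of_ne (by omega), mul_assoc]
      congr 3
      refine Finset.prod_congr rfl fun j hj => ?_
      have := Finset.mem_range.1 hj
      rw [Function.update_of_ne (by omega), Function.update_of_ne (by omega)]
    rw [hsplit (k + n + 1), hval, hval, ← ENNReal.ofReal_add (mul_nonneg (hnn n a) (hP0 _ _))
      (mul_nonneg (hnn n a) (hP0 _ _)), ← mul_add, hP1, mul_one]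
  have hleft : ∀ k n, formula (k - 1) (n + 1) → formula k n := by
    intro k n h a
    have hset : ∀ e, cylinderSet k n a ∩ {η | η (k - 1) = e} =
        cylinderSet (k - 1) (n + 1) (cons e a) := by
      intro e
      ext η
      constructor
      · rintro ⟨h1, h2⟩ (_ | j) hj
        · simpa using h2
        · have := h1 j (by omega)
          rw [cons_succ, ← this]
          congr 1
          push_cast
          ring
      · intro h1
        refine ⟨fun j hj => ?_, by simpa using h1 0 (by omega)⟩
        have := h1 (j + 1) (by omega)
        rw [cons_succ] at this
        rw [← this]
        congr 1
        push_cast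
        ring
    have hval : ∀ e, chainMeasure q r (cylinderSet k n a ∩ {η | η (k - 1) = e}) =
        ENNReal.ofReal (π (a 0) * (∏ j ∈ Finset.range n, P (a j) (a (j + 1))) * P (a 0) e) := by
      intro e
      rw [hset, h, Finset.prod_range_succ']
      simp only [cons_succ, cons_zero]
      rw [mul_comm (∏ j ∈ Finset.range n, _), ← mul_assoc, hrev]
      congr 1
      ring
    rw [hsplit (k - 1), hval, hval, ← ENNReal.ofReal_add (mul_nonneg (hnn n a) (hP0 _ _))
      (mul_nonneg (hnn n a) (hP0 _ _)), ← mul_add, hP1, mul_one]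
  have hrights : ∀ i k n, formula k (n + i) → formula k n := by
    intro i
    induction i with
    | zero => exact fun k n h => h
    | succ i ih => exact fun k n h => ih k n (hright k (n + i) h)
  have hlefts : ∀ (i : ℕ) k n, formula (k - i) (n + i) → formula k n := by
    intro i
    induction i with
    | zero => intro k n h; simpa using h
    | succ i ih =>
      intro k n h
      refine ih k n (hleft (k - i) (n + i) ?_)
      rw [show k - i - 1 = k - ((i + 1 : ℕ) : ℤ) by push_cast; ring]
      exact h
  intro k n
  refine hlefts k.natAbs k n (hrights (k.natAbs + k.natAbs) _ _ ?_)
  obtain ⟨m, hm⟩ : ∃ m : ℕ, k - k.natAbs = -m := ⟨(k.natAbs - k).toNat, by omega⟩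
  obtain ⟨n', hn'⟩ : ∃ n' : ℕ, n + k.natAbs + (k.natAbs + k.natAbs) = m + n' :=
    ⟨n + k.natAbs + (k.natAbs + k.natAbs) - m, by omega⟩
  rw [hm, hn']
  exact chainMeasure_cylinderSet_origin q r hπ hP hrev m n'

/-! ### Existence and jump rate of invariant Markov measures -/

lemma exists_isMarkovInvariant {p : unitInterval} (hp0 : 0 < (p : ℝ)) (hp1 : (p : ℝ) < 1) {ρ : ℝ}
    (hρ0 : 0 < ρ) (hρ1 : ρ < 1) :
    ∃ (P : Matrix (Fin 2) (Fin 2) ℝ) (μ : Measure (ℤ → Fin 2)), IsMarkovInvariant p ρ P μ := by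
  obtain ⟨hv0, hvp, -, hv⟩ := velocity_spec hp0 hp1 hρ0 hρ1.le
  set v := velocity p ρ
  have hvpos : 0 < v := by
    refine hv0.lt_of_ne fun h => ?_
    rw [← h] at hv
    nlinarith [mul_pos hp0 (sub_pos.2 hρ1)]
  -- The transition probabilities are determined by `v = p a` and by `(1 - ρ) b = ρ a`.
  set a : ℝ := v / p with ha
  have hpa : p * a = v := by rw [ha]; field_simp
  have ha0 : 0 < a := div_pos hvpos hp0
  have ha1 : a < 1 := (div_lt_one hp0).2 hvp
  have h1ρ : 0 < 1 - ρ := by linarith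
  set b : ℝ := ρ * a / (1 - ρ) with hb
  have hb0 : 0 < b := div_pos (mul_pos hρ0 ha0) h1ρ
  have hρb : (1 - ρ) * b = ρ * a := by rw [hb]; field_simp
  have hab : a + b = 1 + p * a * b := by
    have h1 : p * (1 - ρ) * (a + b - (1 + p * a * b)) = 0 := by
      have h2 : p * (ρ * p * a ^ 2 - a + (1 - ρ)) = 0 := by
        rw [← hpa] at hv
        linear_combination hv
      linear_combination p * (1 - p * a) * hρb - h2
    have h3 : p * (1 - ρ) ≠ 0 := (mul_pos hp0 h1ρ).ne'
    linarith [(mul_eq_zero.1 h1).resolve_left h3]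
  have hb1 : b < 1 := by
    have : 0 < 1 - p * a := by linarith
    by_contra! h
    nlinarith
  let q : unitInterval := ⟨ρ, hρ0.le, hρ1.le⟩
  let r : Fin 2 → unitInterval :=
    ![⟨b, hb0.le, hb1.le⟩, ⟨1 - a, by linarith, by linarith⟩]
  let π : Fin 2 → ℝ := ![1 - ρ, ρ]
  let P : Matrix (Fin 2) (Fin 2) ℝ := !![1 - b, b; a, 1 - a]
  have hπq : ∀ e, letterWeight q e = π e := by
    intro e; fin_cases e <;> simp [letterWeight, q, π]
  have hPr : ∀ e f, letterWeight (r e) f = P e f := by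
    intro e f; fin_cases e <;> fin_cases f <;> simp [letterWeight, r, P]
  have hrev : ∀ e f, π e * P e f = π f * P f e := by
    intro e f; fin_cases e <;> fin_cases f <;> simp [π, P, hρb]
  have hπ0 : ∀ e, 0 ≤ π e := fun e => hπq e ▸ letterWeight_nonneg _ _
  have hPpos : ∀ e f, 0 < P e f := by
    intro e f; fin_cases e <;> fin_cases f <;> simp [P] <;> assumption
  have hcyl := cylinderFormula_chainMeasure q r hπq hPr hrev
  refine ⟨P, chainMeasure q r, inferInstance, ⟨hPpos, fun e => ?_⟩,
    ⟨π, hπ0, by simp [π], ?_, hcyl⟩,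
    invariant_of_cylinderFormula (fun e f => (hPpos e f).le) hπ0 hcyl rfl ?_ (hrev 0 1) hab,
    fun k => ?_⟩
  · fin_cases e <;> simp [P]
  · ext e
    rw [Matrix.vecMul, dotProduct, Fin.sum_univ_two]
    fin_cases e <;> simp [π, P] <;> linarith
  · simp [P]
  · have h := hcyl k 0 fun _ => 1
    simpa [cylinderSet, π] using h

lemma transition_eq_velocity {p : unitInterval} (hp0 : 0 < (p : ℝ)) (hp1 : (p : ℝ) < 1) {ρ : ℝ}
    (hρ0 : 0 < ρ) (hρ1 : ρ < 1) {P : Matrix (Fin 2) (Fin 2) ℝ} {μ : Measure (ℤ → Fin 2)}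
    (h : IsMarkovInvariant p ρ P μ) : (p : ℝ) * P 1 0 = velocity p ρ := by
  have := h.isProbabilityMeasure
  obtain ⟨hPpos, hP1⟩ := h.positiveStochastic
  obtain ⟨π, hπ0, hπ1, hπP, hcyl⟩ := h.markov
  have hcyl' : CylinderFormula P π μ := hcyl
  have hπρ : π 1 = ρ := by
    have h1 := hcyl' 0 0 fun _ => 1
    have h2 := h.density 0
    have h3 : cylinderSet 0 0 (fun _ => 1) = {η : ℤ → Fin 2 | η 0 = 1} := by
      ext η
      simp [cylinderSet]
    rw [h3, h2] at h1
    simpa using ((ENNReal.ofReal_eq_ofReal_iff hρ0.le (by simpa using hπ0 1)).1 h1).symm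
  have hr0 := hP1 0
  have hr1 := hP1 1
  have hl := congr_fun hπP 1
  rw [Fin.sum_univ_two] at hr0 hr1 hπ1
  rw [Matrix.vecMul, dotProduct, Fin.sum_univ_two] at hl
  have hrev : π 0 * P 0 1 = π 1 * P 1 0 := by linear_combination hl - π 1 * hr1
  have hab := transition_of_invariant hp0 hPpos hπ0 hcyl' (by linarith) (by linarith) hrev
    (hπρ ▸ hρ0) h.invariant
  refine mul_eq_velocity (b := P 0 1) hp0 hp1 hρ0 hρ1 (hPpos 1 0) (by linarith [hPpos 1 1])
    (by linarith [hPpos 0 0]) ?_ hab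
  rw [show 1 - ρ = π 0 by linarith, hrev, hπρ]

end LatticeTASEP

theorem lemmal (p : unitInterval) (hp0 : 0 < (p : ℝ)) (hp1 : (p : ℝ) < 1)
    (ρ : ℝ) (hρ0 : 0 < ρ) (hρ1 : ρ ≤ 1) :
    (∀ x : ℤ → ℤ, LatticeTASEP.Admissible x → LatticeTASEP.HasDensity x ρ →
      LatticeTASEP.HasVelocity p x
        ((1 - Real.sqrt (1 - 4 * (p : ℝ) * ρ * (1 - ρ))) / (2 * ρ))) ∧
    (ρ < 1 →
      (∃ (P : Matrix (Fin 2) (Fin 2) ℝ) (μ : MeasureTheory.Measure (ℤ → Fin 2)),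
        LatticeTASEP.IsMarkovInvariant p ρ P μ) ∧
      ∀ (P : Matrix (Fin 2) (Fin 2) ℝ) (μ : MeasureTheory.Measure (ℤ → Fin 2)),
        LatticeTASEP.IsMarkovInvariant p ρ P μ →
          (p : ℝ) * P 1 0 =
            (1 - Real.sqrt (1 - 4 * (p : ℝ) * ρ * (1 - ρ))) / (2 * ρ)) :=
  ⟨fun _ hx hd => LatticeTASEP.hasVelocity hp0 hp1 hρ0 hρ1 hx hd, fun hρ1' =>
    ⟨LatticeTASEP.exists_isMarkovInvariant hp0 hp1 hρ0 hρ1', fun _ _ h =>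
      LatticeTASEP.transition_eq_velocity hp0 hp1 hρ0 hρ1' h⟩⟩
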